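/- Let $n\ge 2$ and $m\ge 0$ be integers. For a tempered distribution $f\in\mathcal S'(\mathbf R^n;\mathbf C^m)$ let $\hat f$ be its Fourier transform, normalized by $\hat\varphi(\xi)=(2\pi)^{-n/2}\int e^{-ix\cdot\xi}\varphi(x)\,dx$ on Schwartz functions. **Kernels.** A *majorizing kernel with exponent* $\theta\ge 0$ is a function $h:\mathbf R^n\to(0,\infty]$ that is a tempered distribution (locally integrable), is finite almost everywhere, and satisfies, for some constant $B>0$, $$\int_{\mathbf R^n}h(\xi-\eta)h(\eta)\,d\eta\le B|\xi|^\theta h(\xi)\qquad(\xi\ne 0).$$ For $\alpha\ge 0$ and $\omega>0$, $\mathcal H^\theta_{\alpha,\omega}(\mathbf R^n)$ is the class of those majorizing kernels $h$ with exponent $\theta$ such that $h(\xi)=O(|\xi|^{-\alpha})$ and $|\xi|^{-\alpha}=O(h(\xi))$ as $\xi\to0$, $h(\xi)=O(|\xi|^{-\omega})$ and $|\xi|^{-\omega}=O(h(\xi))$ as $\xi\to\infty$, and $h$ is bounded on the complement of every neighbourhood of the origin. **Spaces.** All spaces consist of the $f\in\mathcal S'(\mathbf R^n;\mathbf C^m)$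 for which the norm is finite; for the first two it is also required that $\hat f\in L^1_{\rm loc}$: $$\|f\|_{\mathcal F_h}=\operatorname*{ess\,sup}_\xi h(\xi)^{-1}|\hat f(\xi)|,\qquad \|f\|_{PM^a}=\operatorname*{ess\,sup}_\xi|\xi|^a|\hat f(\xi)|,$$ $$\|f\|_{BMO^{-1}}=\sup_{x\in\mathbf R^n,\;R>0}\Big(\frac1{|B(x,R)|}\int_0^{R^2}\!\!\int_{B(x,R)}|e^{t\Delta}f|^2\,dy\,dt\Big)^{1/2},$$ and $\|f\|_{BMO_T^{-1}}$, $T>0$, is defined by the same formula with the supremum taken only over $x\in\mathbf R^n$ and $R>0$ with $R^2<T$. Here $e^{t\Delta}f$ is the convolution of $f$ with the heat kernel $(4\pi t)^{-n/2}e^{-|x|^2/(4t)}$. We write $X\hookrightarrow Y$ if $X\subseteq Y$ and $\|f\|_Y\le C\|f\|_X$ for all $f\in X$, with a constant $C$ independent of $f$. **Theorem.** 1. If $h\in\mathcal H^1_{\alpha,\omega}(\mathbf R^n)$ for some $\alpha\ge0$, $\omega>0$, then $\mathcal F_h\hookrightarrow PM^{n-1}$; moreover $PM^{n-1}\hookrightarrow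 BMO^{-1}$. 2. Let $0<\theta<1$. If $h\in\mathcal H^\theta_{\alpha,\omega}(\mathbf R^n)$ for some $\alpha\ge0$, $\omega>0$, then $\mathcal F_h\hookrightarrow PM^{n-\theta}$; moreover $PM^{n-\theta}\hookrightarrow BMO_T^{-1}$ for all $T>0$, and there is a constant $C$, independent of $T$, $h$ and $f$, such that $$\|f\|_{BMO_T^{-1}}\le C\,T^{(1-\theta)/2}\,\|f\|_{PM^{n-\theta}}\qquad\text{for all }T>0,\ f\in PM^{n-\theta}.$$ -/

import Mathlib

open MeasureTheory Filter Topology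
open scoped SchwartzMap FourierTransform ENNReal NNReal

noncomputable section

namespace Majorization

/-- `ℝⁿ` with its Euclidean norm. -/
abbrev Space (n : ℕ) : Type := EuclideanSpace ℝ (Fin n)

/-- `ℂᵐ` with its Euclidean norm. -/
abbrev Vec (m : ℕ) : Type := EuclideanSpace ℂ (Fin m)

/-! ### Tempered distributions and functions, the Fourier transform -/

/-- The tempered distribution `T` is the locally integrable function `g`: the two agree as
distributions, that is, on smooth compactly supported test functions. -/
def IsFunction {n : ℕ} {F : Type*} [NormedAddCommGroup F] [NormedSpace ℂ F]
    (T : 𝓢'(Space n, F)) (g : Space n → F) : Prop :=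
  LocallyIntegrable g volume ∧
    ∀ φ : 𝓢(Space n, ℂ), HasCompactSupport φ → T φ = ∫ ξ, φ ξ • g ξ

/-- The dilation `ξ ↦ (2π)⁻¹ ξ` of `ℝⁿ`. -/
def dilation (n : ℕ) : Space n ≃L[ℝ] Space n :=
  ContinuousLinearEquiv.smulLeft (Units.mk0 ((2 * Real.pi)⁻¹) (by positivity))

/-- The unitary Fourier transform with angular frequency on Schwartz functions,
`φ̂(ξ) = (2π)^{-n/2} ∫ e^{-i x·ξ} φ(x) dx`, obtained from Mathlib's
`𝓕 φ (ξ) = ∫ e^{-2πi x·ξ} φ(x) dx` by the dilation `ξ ↦ (2π)⁻¹ ξ`. -/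
def schwartzFourier (n : ℕ) : 𝓢(Space n, ℂ) →L[ℂ] 𝓢(Space n, ℂ) :=
  (((2 * Real.pi) ^ (-(n : ℝ) / 2) : ℝ) : ℂ) •
    ((SchwartzMap.compCLMOfContinuousLinearEquiv ℂ (dilation n)).comp
      (FourierTransform.fourierCLM ℂ 𝓢(Space n, ℂ)))

/-- The formula for the Fourier transform of a Schwartz function. -/
theorem schwartzFourier_apply (n : ℕ) (φ : 𝓢(Space n, ℂ)) (ξ : Space n) :
    schwartzFourier n φ ξ = (((2 * Real.pi) ^ (-(n : ℝ) / 2) : ℝ) : ℂ) *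
      ∫ x, Complex.exp (-(Complex.I * ((inner ℝ x ξ : ℝ) : ℂ))) * φ x := by
  have h1 : schwartzFourier n φ ξ = (((2 * Real.pi) ^ (-(n : ℝ) / 2) : ℝ) : ℂ) *
      𝓕 (φ : Space n → ℂ) ((2 * Real.pi)⁻¹ • ξ) := rfl
  rw [h1, Real.fourier_eq']
  congr 2
  funext x
  rw [smul_eq_mul, inner_smul_right]
  congr 2
  push_cast
  have : (Real.pi : ℂ) ≠ 0 := by exact_mod_cast Real.pi_ne_zero
  field_simp

/-- The Fourier transform of a tempered distribution, `⟨f̂, φ⟩ = ⟨f, φ̂⟩`. -/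
def fourierDist {n m : ℕ} (f : 𝓢'(Space n, Vec m)) : 𝓢'(Space n, Vec m) :=
  PointwiseConvergenceCLM.precomp (Vec m) (schwartzFourier n) f

/-! ### Majorizing kernels -/

/-- A majorizing kernel `h : ℝⁿ → (0, ∞]` with exponent `θ`.  At `ξ = 0` the right-hand side of the
convolution inequality is the undefined product `0 · ∞` when `θ > 0` and `h 0 = ∞` (for instance
for `h ξ = |ξ|^{-(n-θ)}`), so the inequality is imposed at the points `ξ ≠ 0`. -/
structure IsMajorizingKernel (n : ℕ) (θ : ℝ) (h : Space n → ℝ≥0∞) : Prop where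
  exponent_nonneg : 0 ≤ θ
  pos : ∀ ξ, 0 < h ξ
  tempered : ∃ T : 𝓢'(Space n, ℂ), IsFunction T (fun ξ => ((h ξ).toReal : ℂ))
  conv_le : ∃ B : ℝ≥0, 0 < B ∧ ∀ ξ : Space n, ξ ≠ 0 →
    ∫⁻ η, h (ξ - η) * h η ≤ B * ENNReal.ofReal (‖ξ‖ ^ θ) * h ξ
  infinite_null : volume {ξ | h ξ = ∞} = 0

/-- `h` behaves like `|ξ|^{-a}` along the filter `l`: each of the two functions is `O` of the
other. -/
def BehavesLike {n : ℕ} (l : Filter (Space n)) (h : Space n → ℝ≥0∞) (a : ℝ) : Prop :=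
  (∃ C : ℝ≥0, ∀ᶠ ξ in l, h ξ ≤ C * ENNReal.ofReal (‖ξ‖ ^ (-a))) ∧
    ∃ C : ℝ≥0, ∀ᶠ ξ in l, ENNReal.ofReal (‖ξ‖ ^ (-a)) ≤ C * h ξ

/-- Majorizing kernels with exponent `θ` and radial algebraic growth and decay: they behave as
`|ξ|^{-α}` at the origin, as `|ξ|^{-ω}` at infinity, and are bounded off every neighbourhood of the
origin. -/
structure IsRadialAlgebraicKernel (n : ℕ) (θ α ω : ℝ) (h : Space n → ℝ≥0∞) : Prop
    extends IsMajorizingKernel n θ h where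
  alpha_nonneg : 0 ≤ α
  omega_pos : 0 < ω
  origin : BehavesLike (𝓝[≠] 0) h α
  infinity : BehavesLike (cocompact (Space n)) h ω
  bounded : ∀ U ∈ 𝓝 (0 : Space n), ∃ C : ℝ≥0, ∀ ξ ∉ U, h ξ ≤ C

/-! ### The function spaces

Each space consists of the tempered distributions at which its extended norm is finite. -/

/-- The extended norm of the majorization space `F_h`: the essential supremum of `h⁻¹ |f̂|` if `f̂`
is a locally integrable function (which is then unique almost everywhere), and `∞` otherwise. -/
def majorizationNorm {n m : ℕ} (h : Space n → ℝ≥0∞) (f : 𝓢'(Space n, Vec m)) : ℝ≥0∞ :=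
  ⨅ (g : Space n → Vec m) (_ : IsFunction (fourierDist f) g),
    essSup (fun ξ => (h ξ)⁻¹ * ‖g ξ‖ₑ) volume

/-- The extended norm of the pseudomeasure space `PM^a`: the essential supremum of `|ξ|^a |f̂(ξ)|`
if `f̂` is a locally integrable function, and `∞` otherwise. -/
def pmNorm {n m : ℕ} (a : ℝ) (f : 𝓢'(Space n, Vec m)) : ℝ≥0∞ :=
  ⨅ (g : Space n → Vec m) (_ : IsFunction (fourierDist f) g),
    essSup (fun ξ => ENNReal.ofReal (‖ξ‖ ^ a) * ‖g ξ‖ₑ) volume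

/-- A polynomial times a Gaussian is bounded. -/
theorem poly_mul_gaussian_le (a : ℝ) (ha : 0 < a) (M : ℕ) (r : ℝ) (hr : 0 ≤ r) :
    (1 + r) ^ M * Real.exp (-(a * r ^ 2)) ≤ Real.exp a * (M.factorial * (2 / a) ^ M) := by
  have h1 : (a * (1 + r) ^ 2 / 2) ^ M / M.factorial ≤ Real.exp (a * (1 + r) ^ 2 / 2) :=
    Real.pow_div_factorial_le_exp _ (by positivity) M
  have h2 : Real.exp (-(a * r ^ 2)) ≤ Real.exp a * Real.exp (-(a * (1 + r) ^ 2 / 2)) := by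
    rw [← Real.exp_add]
    apply Real.exp_le_exp.2
    nlinarith [sq_nonneg (r - 1), mul_nonneg ha.le (sq_nonneg (r - 1))]
  have h3 : (1 + r) ^ M ≤ ((1 + r) ^ 2) ^ M := by
    rw [← pow_mul]
    exact pow_le_pow_right₀ (by linarith) (by omega)
  have h4 : ((1 + r) ^ 2) ^ M =
      (M.factorial * (2 / a) ^ M) * ((a * (1 + r) ^ 2 / 2) ^ M / M.factorial) := by
    have : (M.factorial : ℝ) ≠ 0 := by exact_mod_cast M.factorial_ne_zero
    have h5 : (1 + r) ^ 2 = (2 / a) * (a * (1 + r) ^ 2 / 2) := by field_simp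
    rw [mul_assoc, mul_div_assoc', ← mul_pow, ← h5, mul_div_cancel₀ _ this]
  calc (1 + r) ^ M * Real.exp (-(a * r ^ 2))
      ≤ ((M.factorial * (2 / a) ^ M) * Real.exp (a * (1 + r) ^ 2 / 2)) *
          (Real.exp a * Real.exp (-(a * (1 + r) ^ 2 / 2))) := by
        rw [h4] at h3
        gcongr
        exact h3.trans (by gcongr)
    _ = Real.exp a * (M.factorial * (2 / a) ^ M) := by
        rw [Real.exp_neg]
        field_simp

/-- Gaussians satisfy the Schwartz decay estimates. -/
theorem gaussian_decay (n : ℕ) (a : ℝ) (ha : 0 < a) (k l : ℕ) :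
    ∃ C : ℝ, ∀ x : Space n,
      ‖x‖ ^ k * ‖iteratedFDeriv ℝ l (fun x : Space n => Real.exp (-(a * ‖x‖ ^ 2))) x‖ ≤ C := by
  have hgrow : (fun x : Space n => -(a * ‖x‖ ^ 2)).HasTemperateGrowth :=
    ((Function.HasTemperateGrowth.const a).mul
      (Function.hasTemperateGrowth_norm_sq (H := Space n))).neg
  obtain ⟨p, K, hK, hb⟩ := hgrow.norm_iteratedFDeriv_le_uniform l
  refine ⟨l.factorial * (1 + K) ^ l *
    (Real.exp a * ((k + p * l).factorial * (2 / a) ^ (k + p * l))), fun x => ?_⟩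
  have hx : 1 ≤ 1 + ‖x‖ := by linarith [norm_nonneg x]
  have hD1 : 1 ≤ (1 + K) * (1 + ‖x‖) ^ p :=
    one_le_mul_of_one_le_of_one_le (by linarith) (one_le_pow₀ hx)
  have hmain := norm_iteratedFDeriv_comp_le (𝕜 := ℝ) (g := Real.exp)
    (f := fun x : Space n => -(a * ‖x‖ ^ 2)) (n := l) (N := ((⊤ : ℕ∞) : WithTop ℕ∞)) Real.contDiff_exp hgrow.1
    (by exact_mod_cast le_top) x (C := Real.exp (-(a * ‖x‖ ^ 2)))
    (D := (1 + K) * (1 + ‖x‖) ^ p)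
    (fun i _ => by
      rw [norm_iteratedFDeriv_eq_norm_iteratedDeriv, iteratedDeriv_eq_iterate, Real.iter_deriv_exp,
        Real.norm_of_nonneg (Real.exp_pos _).le])
    (fun i hi hil => (hb i hil x).trans <|
      (mul_le_mul_of_nonneg_right (by linarith) (by positivity)).trans
        (le_self_pow₀ hD1 (by omega)))
  calc ‖x‖ ^ k * ‖iteratedFDeriv ℝ l (fun x : Space n => Real.exp (-(a * ‖x‖ ^ 2))) x‖
      ≤ (1 + ‖x‖) ^ k * (l.factorial * Real.exp (-(a * ‖x‖ ^ 2)) *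
          ((1 + K) * (1 + ‖x‖) ^ p) ^ l) := by
        gcongr
        · linarith
        · exact hmain
    _ = l.factorial * (1 + K) ^ l *
          ((1 + ‖x‖) ^ (k + p * l) * Real.exp (-(a * ‖x‖ ^ 2))) := by
        rw [mul_pow, ← pow_mul, pow_add]
        ring
    _ ≤ _ := mul_le_mul_of_nonneg_left (poly_mul_gaussian_le a ha _ _ (norm_nonneg x))
        (by positivity)

/-- The Gaussian `x ↦ e^{-a|x|²}`, `a > 0`, as a Schwartz function. -/
def gaussian (n : ℕ) (a : ℝ) (ha : 0 < a) : 𝓢(Space n, ℝ) where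
  toFun x := Real.exp (-(a * ‖x‖ ^ 2))
  smooth' := Real.contDiff_exp.comp ((contDiff_const.mul (contDiff_norm_sq ℝ)).neg)
  decay' := gaussian_decay n a ha

/-- The heat kernel centred at `y`, `x ↦ (4πt)^{-n/2} e^{-|x-y|²/(4t)}`, as a Schwartz function;
it is used for `t > 0` only. -/
def heatKernel (n : ℕ) (t : ℝ) (y : Space n) : 𝓢(Space n, ℂ) :=
  if ht : 0 < t then
    (((4 * Real.pi * t) ^ (-(n : ℝ) / 2) : ℝ) : ℂ) •
      SchwartzMap.compSubConstCLM ℂ y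
        (SchwartzMap.postcompCLM Complex.ofRealCLM (gaussian n (1 / (4 * t)) (by positivity)))
  else 0

/-- The formula for the heat kernel. -/
theorem heatKernel_apply (n : ℕ) (t : ℝ) (ht : 0 < t) (y x : Space n) :
    heatKernel n t y x =
      (((4 * Real.pi * t) ^ (-(n : ℝ) / 2) * Real.exp (-(‖x - y‖ ^ 2 / (4 * t))) : ℝ) : ℂ) := by
  have h1 : heatKernel n t y x = (((4 * Real.pi * t) ^ (-(n : ℝ) / 2) : ℝ) : ℂ) *
      ((Real.exp (-(1 / (4 * t) * ‖x - y‖ ^ 2)) : ℝ) : ℂ) := by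
    simp only [heatKernel, ht, dif_pos]
    rfl
  rw [h1, ← Complex.ofReal_mul, one_div, inv_mul_eq_div]

/-- The caloric extension `(e^{tΔ} f)(y)`, `t > 0`, of a tempered distribution: the pairing of `f`
with the heat kernel centred at `y`. -/
def heat {n m : ℕ} (f : 𝓢'(Space n, Vec m)) (t : ℝ) (y : Space n) : Vec m :=
  f (heatKernel n t y)

/-- `( |B(x,R)|⁻¹ ∫_0^{R²} ∫_{B(x,R)} |e^{tΔ} f|² dy dt )^{1/2}`. -/
def carleson {n m : ℕ} (f : 𝓢'(Space n, Vec m)) (x : Space n) (R : ℝ) : ℝ≥0∞ :=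
  ((volume (Metric.ball x R))⁻¹ *
    ∫⁻ t in Set.Ioo 0 (R ^ 2), ∫⁻ y in Metric.ball x R, ‖heat f t y‖ₑ ^ 2) ^ (1 / 2 : ℝ)

/-- The extended norm of `BMO⁻¹`. -/
def bmoInvNorm {n m : ℕ} (f : 𝓢'(Space n, Vec m)) : ℝ≥0∞ :=
  ⨆ (x : Space n) (R : ℝ) (_ : 0 < R), carleson f x R

/-- The extended norm of `BMO_T⁻¹`: only the balls with `R² < T` are considered. -/
def bmoInvNormLocal {n m : ℕ} (T : ℝ) (f : 𝓢'(Space n, Vec m)) : ℝ≥0∞ :=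
  ⨆ (x : Space n) (R : ℝ) (_ : 0 < R) (_ : R ^ 2 < T), carleson f x R

/-- The space `{N₁ < ∞}` is continuously embedded in the space `{N₂ < ∞}`: it is contained in it,
and the inclusion is bounded. -/
def ContinuouslyEmbeds {n m : ℕ} (N₁ N₂ : 𝓢'(Space n, Vec m) → ℝ≥0∞) : Prop :=
  (∀ f, N₁ f < ∞ → N₂ f < ∞) ∧ ∃ C : ℝ≥0, ∀ f, N₁ f < ∞ → N₂ f ≤ C * N₁ f

end Majorization

end

/-!
Testing the convolution inequality on the ball of radius `|ξ|/4` around `ξ/2`, where both `η` and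
`ξ - η` have size comparable to `|ξ|`, gives `|ξ|^(n - θ - a) ≲ 1` whenever `h` behaves like
`|ξ|^(-a)` near `ξ`. Letting `ξ → 0` and `ξ → ∞` forces `α ≤ n - θ ≤ ω`, hence
`h ≲ |ξ|^(-(n - θ))` everywhere, which is the embedding of `F_h` in `PM^(n - θ)`.

For the Carleson functional of `f ∈ PM^a` on `B(x, R)`, split `f̂` at the frequency `|ξ| = 1/R`. The
low frequencies are integrable and bound the caloric extension pointwise. The high frequencies are
square integrable after division by `|ξ|`: by Plancherel, integrating `|e^{-t|ξ|²}|²` in time gains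
exactly the factor `|ξ|⁻²`. Both contributions scale like `R^(2(a + 1 - n))`.
-/

noncomputable section

namespace Majorization

section Convolution

variable {E : Type*} [NormedAddCommGroup E] [NormedSpace ℝ E]

theorem norm_mem_Icc_of_mem_ball_half_smul {ξ η : E}
    (hη : η ∈ Metric.ball ((1 / 2 : ℝ) • ξ) (‖ξ‖ / 4)) : ‖η‖ ∈ Set.Icc (‖ξ‖ / 4) ‖ξ‖ := by
  rw [mem_ball_iff_norm] at hη
  have hhalf : ‖(1 / 2 : ℝ) • ξ‖ = ‖ξ‖ / 2 := by
    rw [norm_smul, Real.norm_of_nonneg (by norm_num), one_div_mul_eq_div]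
  have hupper := norm_sub_norm_le η ((1 / 2 : ℝ) • ξ)
  have hlower := norm_sub_norm_le ((1 / 2 : ℝ) • ξ) η
  rw [norm_sub_rev] at hlower
  constructor <;> linarith

theorem sub_mem_ball_half_smul {ξ η : E} {r : ℝ} (hη : η ∈ Metric.ball ((1 / 2 : ℝ) • ξ) r) :
    ξ - η ∈ Metric.ball ((1 / 2 : ℝ) • ξ) r := by
  rw [mem_ball_iff_norm] at hη ⊢
  rwa [show ξ - η - (1 / 2 : ℝ) • ξ = -(η - (1 / 2 : ℝ) • ξ) by module, norm_neg]

variable [MeasurableSpace E] [BorelSpace E] (μ : Measure E)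

theorem sq_mul_measure_ball_le_lintegral_conv {h : E → ℝ≥0∞} {p : ℝ≥0∞} {ξ : E}
    (hp : ∀ η, ‖η‖ ∈ Set.Icc (‖ξ‖ / 4) ‖ξ‖ → p ≤ h η) :
    p ^ 2 * μ (Metric.ball ((1 / 2 : ℝ) • ξ) (‖ξ‖ / 4)) ≤ ∫⁻ η, h (ξ - η) * h η ∂μ := by
  rw [← setLIntegral_const]
  refine (setLIntegral_mono' measurableSet_ball fun η hη => ?_).trans
    (setLIntegral_le_lintegral _ _)
  rw [sq]
  exact mul_le_mul' (hp _ (norm_mem_Icc_of_mem_ball_half_smul (sub_mem_ball_half_smul hη)))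
    (hp _ (norm_mem_Icc_of_mem_ball_half_smul hη))

theorem rpow_neg_mul_measure_ball_le_of_conv_le {θ a : ℝ} (ha : 0 ≤ a) {h : E → ℝ≥0∞}
    {B C₁ C₂ : ℝ≥0} {ξ : E} (hξ : ξ ≠ 0)
    (hconv : ∫⁻ η, h (ξ - η) * h η ∂μ ≤ B * ENNReal.ofReal (‖ξ‖ ^ θ) * h ξ)
    (hupper : h ξ ≤ C₁ * ENNReal.ofReal (‖ξ‖ ^ (-a)))
    (hlower : ∀ η, ‖η‖ ∈ Set.Icc (‖ξ‖ / 4) ‖ξ‖ → ENNReal.ofReal (‖η‖ ^ (-a)) ≤ C₂ * h η) :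
    ENNReal.ofReal (‖ξ‖ ^ (-a)) * μ (Metric.ball ((1 / 2 : ℝ) • ξ) (‖ξ‖ / 4)) ≤
      (C₂ ^ 2 * B * C₁ : ℝ≥0) * ENNReal.ofReal (‖ξ‖ ^ θ) := by
  have hξ₀ : 0 < ‖ξ‖ := norm_pos_iff.2 hξ
  set p := ENNReal.ofReal (‖ξ‖ ^ (-a))
  have hp₀ : p ≠ 0 := (ENNReal.ofReal_pos.2 (by positivity)).ne'
  have hp : ∀ η, ‖η‖ ∈ Set.Icc (‖ξ‖ / 4) ‖ξ‖ → p ≤ C₂ * h η := fun η hη =>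
    (ENNReal.ofReal_le_ofReal (Real.rpow_le_rpow_of_nonpos (by linarith [hη.1]) hη.2
      (by linarith))).trans (hlower η hη)
  have hchain : p * (p * μ (Metric.ball ((1 / 2 : ℝ) • ξ) (‖ξ‖ / 4))) ≤
      p * ((C₂ ^ 2 * B * C₁ : ℝ≥0) * ENNReal.ofReal (‖ξ‖ ^ θ)) :=
    calc p * (p * μ (Metric.ball ((1 / 2 : ℝ) • ξ) (‖ξ‖ / 4)))
        = p ^ 2 * μ (Metric.ball ((1 / 2 : ℝ) • ξ) (‖ξ‖ / 4)) := by ring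
      _ ≤ ∫⁻ η, C₂ * h (ξ - η) * (C₂ * h η) ∂μ :=
        sq_mul_measure_ball_le_lintegral_conv μ (h := fun η => C₂ * h η) hp
      _ = C₂ ^ 2 * ∫⁻ η, h (ξ - η) * h η ∂μ := by
        rw [← lintegral_const_mul' _ _ (by finiteness)]
        exact lintegral_congr fun η => by ring
      _ ≤ C₂ ^ 2 * (B * ENNReal.ofReal (‖ξ‖ ^ θ) * (C₁ * p)) := by
        gcongr
        exact hconv.trans (by gcongr)
      _ = p * ((C₂ ^ 2 * B * C₁ : ℝ≥0) * ENNReal.ofReal (‖ξ‖ ^ θ)) := by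
        push_cast
        ring
  exact (ENNReal.mul_le_mul_iff_right hp₀ ENNReal.ofReal_ne_top).1 hchain

theorem exists_rpow_finrank_sub_le_of_conv_le [FiniteDimensional ℝ E] [μ.IsAddHaarMeasure]
    {θ a : ℝ} (ha : 0 ≤ a) {h : E → ℝ≥0∞} {B : ℝ≥0} (C₁ C₂ : ℝ≥0)
    (hconv : ∀ ξ, ξ ≠ 0 → ∫⁻ η, h (ξ - η) * h η ∂μ ≤ B * ENNReal.ofReal (‖ξ‖ ^ θ) * h ξ) :
    ∃ K : ℝ, ∀ ξ, ξ ≠ 0 → h ξ ≤ C₁ * ENNReal.ofReal (‖ξ‖ ^ (-a)) →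
      (∀ η, ‖η‖ ∈ Set.Icc (‖ξ‖ / 4) ‖ξ‖ → ENNReal.ofReal (‖η‖ ^ (-a)) ≤ C₂ * h η) →
      ‖ξ‖ ^ (Module.finrank ℝ E - θ - a) ≤ K := by
  set d := Module.finrank ℝ E
  set v := μ.real (Metric.ball 0 1)
  have hv : 0 < v := ENNReal.toReal_pos (Metric.measure_ball_pos _ _ one_pos).ne'
    measure_ball_lt_top.ne
  refine ⟨(C₂ ^ 2 * B * C₁ : ℝ≥0) * (4 ^ d / v), fun ξ hξ hupper hlower => ?_⟩
  have hξ₀ : 0 < ‖ξ‖ := norm_pos_iff.2 hξ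
  have hball : ‖ξ‖ ^ (-a) * ((‖ξ‖ / 4) ^ d * v) ≤ (C₂ ^ 2 * B * C₁ : ℝ≥0) * ‖ξ‖ ^ θ := by
    have := ENNReal.toReal_mono (by finiteness)
      (rpow_neg_mul_measure_ball_le_of_conv_le μ ha hξ (hconv ξ hξ) hupper hlower)
    rwa [Measure.addHaar_ball_of_pos _ _ (by positivity), ENNReal.toReal_mul, ENNReal.toReal_mul,
      ENNReal.toReal_mul, ENNReal.toReal_ofReal (by positivity),
      ENNReal.toReal_ofReal (by positivity), ENNReal.toReal_ofReal (by positivity)] at this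
  have hpow : ‖ξ‖ ^ (d - θ - a) * ‖ξ‖ ^ θ = ‖ξ‖ ^ (-a) * ‖ξ‖ ^ d := by
    rw [← Real.rpow_natCast, ← Real.rpow_add hξ₀, ← Real.rpow_add hξ₀]
    ring_nf
  refine le_of_mul_le_mul_right ?_ (Real.rpow_pos_of_pos hξ₀ θ)
  calc ‖ξ‖ ^ (d - θ - a) * ‖ξ‖ ^ θ
      = ‖ξ‖ ^ (-a) * ((‖ξ‖ / 4) ^ d * v) * (4 ^ d / v) := by
        rw [hpow, div_pow]
        field_simp
    _ ≤ (C₂ ^ 2 * B * C₁ : ℝ≥0) * ‖ξ‖ ^ θ * (4 ^ d / v) := by gcongr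
    _ = (C₂ ^ 2 * B * C₁ : ℝ≥0) * (4 ^ d / v) * ‖ξ‖ ^ θ := by ring

end Convolution

section Exponents

variable {E : Type*} [NormedAddCommGroup E]

theorem eventually_nhdsNE_forall_norm_mem_Icc {p : E → Prop} (hp : ∀ᶠ η in 𝓝[≠] 0, p η) :
    ∀ᶠ ξ in 𝓝[≠] (0 : E), ∀ η, ‖η‖ ∈ Set.Icc (‖ξ‖ / 4) ‖ξ‖ → p η := by
  obtain ⟨δ, hδ, hball⟩ := Metric.mem_nhdsWithin_iff.1 hp
  filter_upwards [inter_mem_nhdsWithin {0}ᶜ (Metric.ball_mem_nhds 0 hδ)] with ξ ⟨hξ, hξδ⟩ η hη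
  have hξ₀ : 0 < ‖ξ‖ := norm_pos_iff.2 hξ
  exact hball ⟨mem_ball_zero_iff.2 (hη.2.trans_lt (mem_ball_zero_iff.1 hξδ)),
    norm_pos_iff.1 (by linarith [hη.1])⟩

theorem eventually_cobounded_forall_norm_mem_Icc {p : E → Prop}
    (hp : ∀ᶠ η in Bornology.cobounded E, p η) :
    ∀ᶠ ξ in Bornology.cobounded E, ∀ η, ‖η‖ ∈ Set.Icc (‖ξ‖ / 4) ‖ξ‖ → p η := by
  obtain ⟨ρ, -, hρ⟩ := (Filter.hasBasis_cobounded_norm (E := E)).eventually_iff.1 hp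
  filter_upwards [tendsto_norm_cobounded_atTop.eventually_ge_atTop (4 * ρ)] with ξ hξ η hη
  exact hρ (by simp only [Set.mem_ofPred_eq]; linarith [hη.1])

theorem exists_forall_le_rpow_of_eventually {h : E → ℝ≥0∞} {b : ℝ} (hb : 0 ≤ b) {C₁ C₂ : ℝ≥0}
    (horigin : ∀ᶠ ξ in 𝓝[≠] 0, h ξ ≤ C₁ * ENNReal.ofReal (‖ξ‖ ^ (-b)))
    (hinfinity : ∀ᶠ ξ in Bornology.cobounded E, h ξ ≤ C₂ * ENNReal.ofReal (‖ξ‖ ^ (-b)))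
    (hbounded : ∀ U ∈ 𝓝 (0 : E), ∃ C : ℝ≥0, ∀ ξ ∉ U, h ξ ≤ C) :
    ∃ C : ℝ≥0, ∀ ξ, ξ ≠ 0 → h ξ ≤ C * ENNReal.ofReal (‖ξ‖ ^ (-b)) := by
  obtain ⟨U, hU, horigin⟩ := mem_nhdsWithin_iff_exists_mem_nhds_inter.1 horigin
  obtain ⟨ρ, -, hinfinity⟩ := (Filter.hasBasis_cobounded_norm (E := E)).eventually_iff.1 hinfinity
  obtain ⟨C₃, hC₃⟩ := hbounded U hU
  refine ⟨C₁ + C₂ + C₃ * (ρ ^ b).toNNReal, fun ξ hξ => ?_⟩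
  have hξ₀ : 0 < ‖ξ‖ := norm_pos_iff.2 hξ
  push_cast
  rw [add_mul, add_mul]
  by_cases hξU : ξ ∈ U
  · exact (horigin ⟨hξU, hξ⟩).trans (le_self_add.trans le_self_add)
  rcases le_total ρ ‖ξ‖ with hξρ | hξρ
  · exact (hinfinity hξρ).trans (le_add_self.trans le_self_add)
  have hρ : 0 < ρ := hξ₀.trans_le hξρ
  have hone : 1 ≤ ((ρ ^ b).toNNReal : ℝ≥0∞) * ENNReal.ofReal (‖ξ‖ ^ (-b)) := by
    change 1 ≤ ENNReal.ofReal _ * _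
    rw [← ENNReal.ofReal_mul (by positivity), ENNReal.one_le_ofReal, Real.rpow_neg hξ₀.le,
      ← div_eq_mul_inv, one_le_div (by positivity)]
    gcongr
  rw [mul_assoc (C₃ : ℝ≥0∞)]
  exact ((hC₃ ξ hξU).trans (le_mul_of_one_le_right' hone)).trans le_add_self

variable [NormedSpace ℝ E] [Nontrivial E] {b K : ℝ}

theorem nonneg_of_eventually_norm_rpow_le_nhdsNE (h : ∀ᶠ ξ in 𝓝[≠] (0 : E), ‖ξ‖ ^ b ≤ K) :
    0 ≤ b := by
  by_contra! hb
  have := Module.punctured_nhds_neBot ℝ E 0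
  obtain ⟨ξ, hle, hlt⟩ := (h.and (((tendsto_rpow_neg_nhdsGT_zero hb).comp
    tendsto_norm_nhdsNE_zero).eventually_gt_atTop K)).exists
  exact hlt.not_ge hle

theorem nonpos_of_eventually_norm_rpow_le_cobounded
    (h : ∀ᶠ ξ in Bornology.cobounded E, ‖ξ‖ ^ b ≤ K) : b ≤ 0 := by
  by_contra! hb
  have := NormedSpace.cobounded_neBot ℝ E
  obtain ⟨ξ, hle, hlt⟩ := (h.and (((tendsto_rpow_atTop hb).comp
    tendsto_norm_cobounded_atTop).eventually_gt_atTop K)).exists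
  exact hlt.not_ge hle

end Exponents

section RadialKernels

variable {n : ℕ} {θ α ω : ℝ} {h : Space n → ℝ≥0∞}

theorem IsRadialAlgebraicKernel.alpha_le [NeZero n] (H : IsRadialAlgebraicKernel n θ α ω h) :
    α ≤ n - θ := by
  obtain ⟨B, -, hconv⟩ := H.conv_le
  obtain ⟨⟨C₁, hupper⟩, C₂, hlower⟩ := H.origin
  obtain ⟨K, hK⟩ := exists_rpow_finrank_sub_le_of_conv_le volume H.alpha_nonneg C₁ C₂ hconv
  rw [finrank_euclideanSpace_fin] at hK
  refine sub_nonneg.1 (nonneg_of_eventually_norm_rpow_le_nhdsNE (E := Space n) (K := K) ?_)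
  filter_upwards [hupper, eventually_nhdsNE_forall_norm_mem_Icc hlower, self_mem_nhdsWithin]
    with ξ hξupper hξlower hξ
  exact hK ξ hξ hξupper hξlower

theorem IsRadialAlgebraicKernel.le_omega [NeZero n] (H : IsRadialAlgebraicKernel n θ α ω h) :
    n - θ ≤ ω := by
  obtain ⟨B, -, hconv⟩ := H.conv_le
  obtain ⟨⟨C₁, hupper⟩, C₂, hlower⟩ := H.infinity
  obtain ⟨K, hK⟩ := exists_rpow_finrank_sub_le_of_conv_le volume H.omega_pos.le C₁ C₂ hconv
  rw [finrank_euclideanSpace_fin] at hK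
  rw [← Metric.cobounded_eq_cocompact] at hupper hlower
  refine sub_nonpos.1 (nonpos_of_eventually_norm_rpow_le_cobounded (E := Space n) (K := K) ?_)
  filter_upwards [hupper, eventually_cobounded_forall_norm_mem_Icc hlower,
    Bornology.eventually_ne_cobounded 0] with ξ hξupper hξlower hξ
  exact hK ξ hξ hξupper hξlower

theorem IsRadialAlgebraicKernel.exists_le_rpow [NeZero n]
    (H : IsRadialAlgebraicKernel n θ α ω h) :
    ∃ C : ℝ≥0, ∀ ξ, ξ ≠ 0 → h ξ ≤ C * ENNReal.ofReal (‖ξ‖ ^ (-(n - θ))) := by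
  obtain ⟨⟨C₁, horigin⟩, -⟩ := H.origin
  obtain ⟨⟨C₂, hinfinity⟩, -⟩ := H.infinity
  rw [← Metric.cobounded_eq_cocompact] at hinfinity
  refine exists_forall_le_rpow_of_eventually (C₁ := C₁) (C₂ := C₂)
    (H.alpha_nonneg.trans H.alpha_le) ?_ ?_ H.bounded
  · filter_upwards [horigin, self_mem_nhdsWithin,
      mem_nhdsWithin_of_mem_nhds (Metric.closedBall_mem_nhds 0 one_pos)] with ξ hle hξ hξ1
    grw [hle]
    gcongr C₁ * ENNReal.ofReal ?_
    exact Real.rpow_le_rpow_of_exponent_ge (norm_pos_iff.2 hξ) (mem_closedBall_zero_iff.1 hξ1)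
      (neg_le_neg H.alpha_le)
  · filter_upwards [hinfinity, tendsto_norm_cobounded_atTop.eventually_ge_atTop 1] with ξ hle hξ1
    grw [hle]
    gcongr C₂ * ENNReal.ofReal ?_
    exact Real.rpow_le_rpow_of_exponent_le hξ1 (neg_le_neg H.le_omega)

end RadialKernels

section Embeddings

variable {n m : ℕ}

theorem continuouslyEmbeds_of_le {N₁ N₂ : 𝓢'(Space n, Vec m) → ℝ≥0∞} {C : ℝ≥0}
    (h : ∀ f, N₂ f ≤ C * N₁ f) : ContinuouslyEmbeds N₁ N₂ :=
  ⟨fun f hf => (h f).trans_lt (ENNReal.mul_lt_top ENNReal.coe_lt_top hf), C, fun f _ => h f⟩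

theorem ofReal_rpow_le_mul_inv_of_le {C : ℝ≥0} (hC : C ≠ 0) {s a : ℝ} (hs : 0 < s) {p : ℝ≥0∞}
    (hp : p ≤ C * ENNReal.ofReal (s ^ (-a))) : ENNReal.ofReal (s ^ a) ≤ C * p⁻¹ := by
  have hC' : (C : ℝ≥0∞) ≠ 0 := ENNReal.coe_ne_zero.2 hC
  calc ENNReal.ofReal (s ^ a)
      = C * (C * ENNReal.ofReal (s ^ (-a)))⁻¹ := by
        rw [ENNReal.mul_inv (.inl hC') (.inl ENNReal.coe_ne_top), ← mul_assoc,
          ENNReal.mul_inv_cancel hC' ENNReal.coe_ne_top, one_mul,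
          ← ENNReal.ofReal_inv_of_pos (by positivity), ← Real.rpow_neg hs.le, neg_neg]
    _ ≤ C * p⁻¹ := by gcongr

theorem continuouslyEmbeds_majorizationNorm_pmNorm [NeZero n] {a : ℝ} {h : Space n → ℝ≥0∞}
    {C : ℝ≥0} (hC : ∀ ξ, ξ ≠ 0 → h ξ ≤ C * ENNReal.ofReal (‖ξ‖ ^ (-a))) :
    ContinuouslyEmbeds (m := m) (majorizationNorm h) (pmNorm a) := by
  refine continuouslyEmbeds_of_le (C := C + 1) fun f => ?_
  have hC₁ : C + 1 ≠ 0 := (zero_lt_one.trans_le le_add_self).ne'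
  unfold majorizationNorm pmNorm
  simp_rw [ENNReal.mul_iInf_of_ne (ENNReal.coe_ne_zero.2 hC₁) ENNReal.coe_ne_top]
  refine iInf₂_mono fun g _ => ?_
  rw [← ENNReal.essSup_const_mul]
  refine essSup_mono_ae ?_
  filter_upwards [Measure.ae_ne volume 0] with ξ hξ
  rw [← mul_assoc]
  gcongr
  refine ofReal_rpow_le_mul_inv_of_le hC₁ (norm_pos_iff.2 hξ) ((hC ξ hξ).trans ?_)
  gcongr
  exact le_self_add

end Embeddings

section Cutoff

variable {E F : Type*} [NormedAddCommGroup E] [NormedSpace ℝ E] [NormedAddCommGroup F]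
  [NormedSpace ℝ F]

theorem exists_norm_iteratedFDeriv_comp_smul_sub_one_le {χ : E → ℝ} (hχ : HasCompactSupport χ)
    (hχ' : ContDiff ℝ (⊤ : ℕ∞) χ) (i : ℕ) :
    ∃ C : ℝ, ∀ s : ℝ, |s| ≤ 1 → ∀ x, ‖iteratedFDeriv ℝ i (fun x => χ (s • x) - 1) x‖ ≤ C := by
  have hi : (i : WithTop ℕ∞) ≤ (⊤ : ℕ∞) := by exact_mod_cast le_top
  obtain ⟨C, hC⟩ := (hχ.iteratedFDeriv (𝕜 := ℝ) i).exists_bound_of_continuous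
    (hχ'.continuous_iteratedFDeriv hi)
  refine ⟨C + 1, fun s hs x => ?_⟩
  have hdilate : ‖iteratedFDeriv ℝ i (fun x => χ (s • x)) x‖ ≤ C := by
    rw [iteratedFDeriv_comp_const_smul s (hχ'.of_le hi), norm_smul, norm_pow, Real.norm_eq_abs]
    exact (mul_le_of_le_one_left (norm_nonneg _) (pow_le_one₀ (abs_nonneg s) hs)).trans (hC _)
  have hconst : ‖iteratedFDeriv ℝ i (fun _ : E => (1 : ℝ)) x‖ ≤ 1 := by
    rcases eq_or_ne i 0 with rfl | h₀
    · simp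
    · simp [iteratedFDeriv_const_of_ne h₀]
  have hcomp : ContDiff ℝ (⊤ : ℕ∞) fun x : E => χ (s • x) := hχ'.comp (contDiff_const_smul s)
  have hsub : iteratedFDeriv ℝ i (fun x => χ (s • x) - 1) x =
      iteratedFDeriv ℝ i (fun x => χ (s • x)) x - iteratedFDeriv ℝ i (fun _ => (1 : ℝ)) x :=
    iteratedFDeriv_sub_apply (hcomp.of_le hi).contDiffAt contDiffAt_const
  rw [hsub]
  exact (norm_sub_le _ _).trans (add_le_add hdilate hconst)

theorem seminorm_smulLeftCLM_le_of_eq_zero_on_ball {w : E → ℝ} (hw : w.HasTemperateGrowth) {r : ℝ}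
    (hr : 0 < r) (hzero : ∀ x, ‖x‖ < r → w x = 0) {D : ℕ → ℝ}
    (hD : ∀ i x, ‖iteratedFDeriv ℝ i w x‖ ≤ D i) (φ : 𝓢(E, F)) (k l : ℕ) :
    SchwartzMap.seminorm ℝ k l (SchwartzMap.smulLeftCLM F w φ) ≤
      (∑ i ∈ Finset.range (l + 1), l.choose i * D i *
        SchwartzMap.seminorm ℝ (k + 1) (l - i) φ) / r := by
  have hD₀ : ∀ i, 0 ≤ D i := fun i => (norm_nonneg _).trans (hD i 0)
  have hsum : 0 ≤ ∑ i ∈ Finset.range (l + 1), l.choose i * D i *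
      SchwartzMap.seminorm ℝ (k + 1) (l - i) φ := Finset.sum_nonneg fun i _ => by
    have := hD₀ i
    positivity
  refine SchwartzMap.seminorm_le_bound ℝ k l _ (by positivity) fun x => ?_
  rw [SchwartzMap.smulLeftCLM_apply hw]
  rcases lt_or_ge ‖x‖ r with hx | hx
  · have hnear : (fun y => w y • φ y) =ᶠ[𝓝 x] fun _ => (0 : F) := by
      filter_upwards [Metric.isOpen_ball.mem_nhds (mem_ball_zero_iff.2 hx)] with y hy
      rw [hzero y (mem_ball_zero_iff.1 hy), zero_smul]
    rw [(hnear.iteratedFDeriv ℝ l).eq_of_nhds, iteratedFDeriv_fun_zero, Pi.zero_apply, norm_zero,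
      mul_zero]
    positivity
  · have hpow : ‖x‖ ^ k ≤ ‖x‖ ^ (k + 1) / r := by
      rw [le_div_iff₀ hr, pow_succ]
      gcongr
    calc ‖x‖ ^ k * ‖iteratedFDeriv ℝ l (fun x => w x • φ x) x‖
        ≤ ‖x‖ ^ (k + 1) / r * ∑ i ∈ Finset.range (l + 1), l.choose i *
            ‖iteratedFDeriv ℝ i w x‖ * ‖iteratedFDeriv ℝ (l - i) φ x‖ := by
          gcongr
          exact norm_iteratedFDeriv_smul_le hw.1 (φ.smooth ⊤) x (by exact_mod_cast le_top)
      _ = (∑ i ∈ Finset.range (l + 1), l.choose i * ‖iteratedFDeriv ℝ i w x‖ *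
            (‖x‖ ^ (k + 1) * ‖iteratedFDeriv ℝ (l - i) φ x‖)) / r := by
          rw [div_mul_eq_mul_div, Finset.mul_sum]
          congr 1
          exact Finset.sum_congr rfl fun i _ => by ring
      _ ≤ _ := by
          gcongr with i
          · exact mul_nonneg (Nat.cast_nonneg _) (hD₀ i)
          · exact hD i x
          · exact φ.le_seminorm ℝ (k + 1) (l - i) x

theorem hasTemperateGrowth_comp_smul {χ : E → ℝ} (hχ : HasCompactSupport χ)
    (hχ' : ContDiff ℝ (⊤ : ℕ∞) χ) {s : ℝ} (hs : s ≠ 0) :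
    (fun x => χ (s • x)).HasTemperateGrowth :=
  (hχ.comp_homeomorph (Homeomorph.smulOfNeZero s hs)).hasTemperateGrowth
    (hχ'.comp (contDiff_const_smul s))

theorem tendsto_smulLeftCLM_comp_smul {χ : E → ℝ} (hχ : HasCompactSupport χ)
    (hχ' : ContDiff ℝ (⊤ : ℕ∞) χ) (hone : ∀ x, ‖x‖ < 1 → χ x = 1) (φ : 𝓢(E, F)) :
    Tendsto (fun s : ℝ => SchwartzMap.smulLeftCLM F (fun x => χ (s • x)) φ) (𝓝[>] 0) (𝓝 φ) := by
  choose D hD using exists_norm_iteratedFDeriv_comp_smul_sub_one_le hχ hχ'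
  rw [(schwartz_withSeminorms ℝ E F).tendsto_nhds]
  rintro ⟨k, l⟩ ε hε
  set M := ∑ i ∈ Finset.range (l + 1), l.choose i * D i * SchwartzMap.seminorm ℝ (k + 1) (l - i) φ
  have hbound : ∀ s ∈ Set.Ioc (0 : ℝ) 1, SchwartzMap.seminorm ℝ k l
      (SchwartzMap.smulLeftCLM F (fun x => χ (s • x)) φ - φ) ≤ M * s := by
    rintro s ⟨hs, hs1⟩
    have hgrowth := hasTemperateGrowth_comp_smul hχ hχ' hs.ne'
    have hgrowth' : (fun x => χ (s • x) - 1).HasTemperateGrowth := hgrowth.sub (.const 1)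
    have hsub : SchwartzMap.smulLeftCLM F (fun x => χ (s • x)) φ - φ =
        SchwartzMap.smulLeftCLM F (fun x => χ (s • x) - 1) φ := by
      ext x
      rw [sub_apply, SchwartzMap.smulLeftCLM_apply_apply hgrowth,
        SchwartzMap.smulLeftCLM_apply_apply hgrowth', sub_smul, one_smul]
    rw [hsub, ← div_inv_eq_mul]
    refine seminorm_smulLeftCLM_le_of_eq_zero_on_ball hgrowth' (inv_pos.2 hs)
      (fun x hx => ?_) (fun i => hD i s (by rwa [abs_of_pos hs])) φ k l
    rw [hone, sub_self]
    rwa [norm_smul, Real.norm_of_nonneg hs.le, ← lt_inv_mul_iff₀ hs, mul_one]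
  have hlim : Tendsto (fun s : ℝ => M * s) (𝓝[>] 0) (𝓝 0) :=
    tendsto_nhdsWithin_of_tendsto_nhds (by simpa using (continuous_const_mul M).tendsto 0)
  filter_upwards [hlim.eventually_lt_const hε, Ioc_mem_nhdsGT one_pos] with s hs hs1
  exact (hbound s hs1).trans_lt hs

end Cutoff

theorem IsFunction.apply_eq_integral {n : ℕ} {F : Type*} [NormedAddCommGroup F] [NormedSpace ℂ F]
    {T : 𝓢'(Space n, F)} {g : Space n → F} (hT : IsFunction T g) (φ : 𝓢(Space n, ℂ))
    (hint : Integrable fun ξ => φ ξ • g ξ) : T φ = ∫ ξ, φ ξ • g ξ := by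
  let χ : ContDiffBump (0 : Space n) := ⟨1, 2, one_pos, one_lt_two⟩
  have hone : ∀ x : Space n, ‖x‖ < 1 → χ x = 1 := fun x hx =>
    χ.one_of_mem_closedBall (mem_closedBall_zero_iff.2 hx.le)
  let u (s : ℝ) : 𝓢(Space n, ℂ) := SchwartzMap.smulLeftCLM ℂ (fun x => χ (s • x)) φ
  have hu {s : ℝ} (hs : 0 < s) (x : Space n) : u s x = χ (s • x) • φ x :=
    SchwartzMap.smulLeftCLM_apply_apply
      (hasTemperateGrowth_comp_smul χ.hasCompactSupport χ.contDiff hs.ne') φ x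
  have hdist : Tendsto (fun s => T (u s)) (𝓝[>] 0) (𝓝 (T φ)) :=
    ((map_continuous T).tendsto φ).comp
      (tendsto_smulLeftCLM_comp_smul χ.hasCompactSupport χ.contDiff hone φ)
  have hintegral : Tendsto (fun s => ∫ ξ, u s ξ • g ξ) (𝓝[>] 0) (𝓝 (∫ ξ, φ ξ • g ξ)) := by
    refine tendsto_integral_filter_of_dominated_convergence (fun ξ => ‖φ ξ • g ξ‖)
      (.of_forall fun s => ?_) ?_ hint.norm (.of_forall fun ξ => ?_)
    · exact (u s).continuous.aestronglyMeasurable.smul hT.1.aestronglyMeasurable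
    · filter_upwards [self_mem_nhdsWithin] with s hs
      refine .of_forall fun ξ => ?_
      rw [norm_smul, norm_smul, hu hs, norm_smul, Real.norm_of_nonneg χ.nonneg]
      gcongr
      exact mul_le_of_le_one_left (norm_nonneg _) χ.le_one
    · have hsmall : Tendsto (fun s : ℝ => ‖s • ξ‖) (𝓝[>] 0) (𝓝 0) :=
        tendsto_nhdsWithin_of_tendsto_nhds (by
          simpa using (by fun_prop : Continuous fun s : ℝ => ‖s • ξ‖).tendsto 0)
      refine tendsto_const_nhds.congr' ?_
      filter_upwards [self_mem_nhdsWithin, hsmall.eventually_lt_const one_pos] with s hs hsξ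
      rw [hu hs, hone _ hsξ, one_smul]
  refine tendsto_nhds_unique hdist (hintegral.congr' ?_)
  filter_upwards [self_mem_nhdsWithin] with s hs
  exact (hT.2 (u s) <| ((χ.hasCompactSupport.comp_homeomorph
    (Homeomorph.smulOfNeZero s hs.ne')).of_isClosed_subset (isClosed_tsupport _)
      ((SchwartzMap.tsupport_smulLeftCLM_subset _ _).trans Set.inter_subset_right))).symm

section Scaling

open Module

variable {E : Type*} [NormedAddCommGroup E] [NormedSpace ℝ E] [FiniteDimensional ℝ E]
  [MeasurableSpace E] [BorelSpace E]

theorem lintegral_eq_mul_lintegral_comp_smul (μ : Measure E) [μ.IsAddHaarMeasure] (f : E → ℝ≥0∞)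
    {r : ℝ} (hr : 0 < r) :
    ∫⁻ x, f x ∂μ = ENNReal.ofReal (r ^ finrank ℝ E) * ∫⁻ x, f (r • x) ∂μ := by
  have hmap : ∫⁻ x, f (r • x) ∂μ = ∫⁻ x, f x ∂(Measure.map (r • ·) μ) :=
    ((Homeomorph.smulOfNeZero r hr.ne').measurableEmbedding.lintegral_map f).symm
  have hpow : 0 < r ^ finrank ℝ E := pow_pos hr _
  rw [hmap, Measure.map_addHaar_smul μ hr.ne', lintegral_smul_measure, smul_eq_mul, ← mul_assoc,
    ← ENNReal.ofReal_mul hpow.le, abs_of_pos (inv_pos.2 hpow), mul_inv_cancel₀ hpow.ne',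
    ENNReal.ofReal_one, one_mul]

end Scaling

theorem lintegral_enorm_sq_eq_eLpNorm_sq {X F : Type*} [MeasurableSpace X] [NormedAddCommGroup F]
    (μ : Measure X) (u : X → F) : ∫⁻ x, ‖u x‖ₑ ^ 2 ∂μ = eLpNorm u 2 μ ^ 2 := by
  simpa using (eLpNorm_nnreal_pow_eq_lintegral (f := u) (μ := μ) (p := 2) two_ne_zero).symm

section Plancherel

variable {E F : Type*} [NormedAddCommGroup E] [InnerProductSpace ℝ E] [FiniteDimensional ℝ E]
  [MeasurableSpace E] [BorelSpace E] [NormedAddCommGroup F] [InnerProductSpace ℂ F]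
  [CompleteSpace F] {G : E → F}

theorem fourier_toLp_ae_eq (h₁ : Integrable G) (h₂ : MemLp G 2) :
    ⇑(𝓕 (h₂.toLp G) : Lp F 2 (volume : Measure E)) =ᵐ[volume] 𝓕 G := by
  set U : Lp F 2 (volume : Measure E) := 𝓕 (h₂.toLp G) with hU
  have hcont : Continuous (𝓕 G) := VectorFourier.fourierIntegral_continuous (L := innerₗ E)
    Real.continuous_fourierChar continuous_inner h₁
  refine ae_eq_of_integral_contDiff_smul_eq ((Lp.memLp U).locallyIntegrable one_le_two)
    hcont.locallyIntegrable fun g hg hgc => ?_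
  let φ : 𝓢(E, ℂ) := HasCompactSupport.toSchwartzMap (f := Complex.ofRealCLM ∘ g)
    (hgc.comp_left rfl) (by fun_prop)
  have hreal (u : E → F) : ∫ x, g x • u x = ∫ x, φ x • u x := rfl
  calc ∫ x, g x • U x = (U : 𝓢'(E, F)) φ := by rw [Lp.toTemperedDistribution_apply, hreal]
    _ = ∫ x, (𝓕 φ) x • h₂.toLp G x := by
      rw [hU, ← Lp.fourier_toTemperedDistribution_eq, TemperedDistribution.fourier_apply,
        Lp.toTemperedDistribution_apply]
    _ = ∫ x, (𝓕 φ) x • G x := integral_congr_ae <| by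
      filter_upwards [h₂.coeFn_toLp] with x hx
      rw [hx]
    _ = ∫ x, φ x • 𝓕 G x := by
      have := VectorFourier.integral_fourierIntegral_smul_eq_flip (L := innerₗ E)
        (μ := (volume : Measure E)) (ν := volume) (f := φ) (g := G)
        Real.continuous_fourierChar continuous_inner φ.integrable h₁
      rwa [flip_innerₗ] at this
    _ = ∫ x, g x • 𝓕 G x := (hreal _).symm

theorem lintegral_enorm_sq_fourier (h₁ : Integrable G) (h₂ : MemLp G 2) :
    ∫⁻ ξ, ‖𝓕 G ξ‖ₑ ^ 2 = ∫⁻ x, ‖G x‖ₑ ^ 2 := by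
  have hnorm : ‖(𝓕 (h₂.toLp G) : Lp F 2 (volume : Measure E))‖ₑ = ‖h₂.toLp G‖ₑ := by
    rw [← ofReal_norm, ← ofReal_norm, Lp.norm_fourier_eq]
  rw [lintegral_enorm_sq_eq_eLpNorm_sq, lintegral_enorm_sq_eq_eLpNorm_sq,
    ← eLpNorm_congr_ae (fourier_toLp_ae_eq h₁ h₂), ← Lp.enorm_def, hnorm, Lp.enorm_toLp]

theorem lintegral_enorm_sq_integral_cexp_inner
    (h₁ : Integrable G) (h₂ : MemLp G 2) :
    ∫⁻ y : E, ‖∫ ξ, Complex.exp (Complex.I * inner ℝ y ξ) • G ξ‖ₑ ^ 2 =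
      ENNReal.ofReal ((2 * Real.pi) ^ Module.finrank ℝ E) * ∫⁻ ξ, ‖G ξ‖ₑ ^ 2 := by
  have hfourier (y : E) :
      ∫ ξ, Complex.exp (Complex.I * inner ℝ ((2 * Real.pi) • y) ξ) • G ξ = 𝓕 G (-y) := by
    rw [Real.fourier_eq']
    refine integral_congr_ae (.of_forall fun ξ => ?_)
    simp only [inner_neg_right, real_inner_smul_left, real_inner_comm y ξ]
    congr 2
    push_cast
    ring
  rw [lintegral_eq_mul_lintegral_comp_smul volume _ Real.two_pi_pos]
  simp only [hfourier]
  rw [lintegral_neg_eq_self fun y => ‖𝓕 G y‖ₑ ^ 2, lintegral_enorm_sq_fourier h₁ h₂]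

end Plancherel

theorem pow_pred_mul_rpow_neg {d : ℕ} (hd : 0 < d) (b : ℝ) {y : ℝ} (hy : 0 < y) :
    y ^ (d - 1) * y ^ (-b) = y ^ ((d : ℝ) - 1 - b) := by
  rw [← Real.rpow_natCast, ← Real.rpow_add hy, Nat.cast_pred hd, sub_eq_add_neg _ b]

section NormPowers

open Module

variable {E : Type*} [NormedAddCommGroup E] [NormedSpace ℝ E] [FiniteDimensional ℝ E]
  [MeasurableSpace E] [BorelSpace E] (μ : Measure E) [μ.IsAddHaarMeasure] {b : ℝ}

theorem setLIntegral_norm_rpow_smul {r : ℝ} (hr : 0 < r) {S₁ S : Set E} (hS₁ : MeasurableSet S₁)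
    (hS : MeasurableSet S) (hmem : ∀ x, r • x ∈ S ↔ x ∈ S₁) :
    ∫⁻ x in S, ENNReal.ofReal (‖x‖ ^ (-b)) ∂μ =
      (∫⁻ x in S₁, ENNReal.ofReal (‖x‖ ^ (-b)) ∂μ) * ENNReal.ofReal (r ^ (finrank ℝ E - b)) := by
  have hscale (x : E) : S.indicator (fun x => ENNReal.ofReal (‖x‖ ^ (-b))) (r • x) =
      ENNReal.ofReal (r ^ (-b)) * S₁.indicator (fun x => ENNReal.ofReal (‖x‖ ^ (-b))) x := by
    by_cases hx : x ∈ S₁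
    · rw [Set.indicator_of_mem hx, Set.indicator_of_mem ((hmem x).2 hx), norm_smul,
        Real.norm_of_nonneg hr.le, Real.mul_rpow hr.le (norm_nonneg _),
        ENNReal.ofReal_mul (by positivity)]
    · rw [Set.indicator_of_notMem hx, Set.indicator_of_notMem (mt (hmem x).1 hx), mul_zero]
  rw [← lintegral_indicator hS, ← lintegral_indicator hS₁,
    lintegral_eq_mul_lintegral_comp_smul μ _ hr]
  simp only [hscale]
  rw [lintegral_const_mul' _ _ ENNReal.ofReal_ne_top, ← mul_assoc,
    ← ENNReal.ofReal_mul (by positivity), mul_comm, ← Real.rpow_natCast, ← Real.rpow_add hr,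
    sub_eq_add_neg]

theorem integrableOn_ball_norm_rpow [Nontrivial E] (hb : b < finrank ℝ E) :
    IntegrableOn (fun x : E => ‖x‖ ^ (-b)) (Metric.ball 0 1) μ := by
  rw [integrableOn_fun_norm_addHaar μ (f := fun y => y ^ (-b))]
  have hpow : IntegrableOn (fun y : ℝ => y ^ ((finrank ℝ E : ℝ) - 1 - b)) (Set.Ioo 0 1) :=
    (intervalIntegral.integrableOn_Ioo_rpow_iff one_pos).2 (by linarith)
  exact hpow.congr_fun (fun y hy => (pow_pred_mul_rpow_neg finrank_pos b hy.1).symm)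
    measurableSet_Ioo

theorem integrableOn_compl_ball_norm_rpow [Nontrivial E] (hb : finrank ℝ E < b) :
    IntegrableOn (fun x : E => ‖x‖ ^ (-b)) (Metric.ball 0 1)ᶜ μ := by
  have hpow : IntegrableOn (fun y : ℝ => y ^ ((finrank ℝ E : ℝ) - 1 - b)) (Set.Ici 1) :=
    (integrableOn_Ici_iff_integrableOn_Ioi (by simp)).2
      ((integrableOn_Ioi_rpow_iff one_pos).2 (by linarith))
  have hradial : IntegrableOn (fun y : ℝ => y ^ (finrank ℝ E - 1) •
      (Set.Ici 1).indicator (fun y : ℝ => y ^ (-b)) y) (Set.Ioi 0) := by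
    refine ((integrable_indicator_iff measurableSet_Ici).2 hpow).integrableOn.congr_fun
      (fun y hy => ?_) measurableSet_Ioi
    rw [smul_eq_mul, Set.indicator_apply, Set.indicator_apply, mul_ite, mul_zero,
      pow_pred_mul_rpow_neg finrank_pos b hy]
  rw [← integrable_fun_norm_addHaar μ] at hradial
  rw [← integrable_indicator_iff measurableSet_ball.compl]
  refine hradial.congr (.of_forall fun x => ?_)
  simp only [Set.indicator, Set.mem_Ici, Set.mem_compl_iff, mem_ball_zero_iff, not_lt]

theorem exists_setLIntegral_ball_norm_rpow_eq [Nontrivial E] (hb : b < finrank ℝ E) :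
    ∃ A : ℝ≥0, ∀ r : ℝ, 0 < r → ∫⁻ x in Metric.ball 0 r, ENNReal.ofReal (‖x‖ ^ (-b)) ∂μ =
      A * ENNReal.ofReal (r ^ (finrank ℝ E - b)) := by
  lift ∫⁻ x in Metric.ball 0 1, ENNReal.ofReal (‖x‖ ^ (-b)) ∂μ to ℝ≥0
    using (integrableOn_ball_norm_rpow μ hb).lintegral_lt_top.ne with A hA
  refine ⟨A, fun r hr => ?_⟩
  rw [hA]
  refine setLIntegral_norm_rpow_smul μ hr measurableSet_ball measurableSet_ball fun x => ?_
  rw [mem_ball_zero_iff, mem_ball_zero_iff, norm_smul, Real.norm_of_nonneg hr.le,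
    mul_lt_iff_lt_one_right hr]

theorem exists_setLIntegral_compl_ball_norm_rpow_eq [Nontrivial E] (hb : finrank ℝ E < b) :
    ∃ A : ℝ≥0, ∀ r : ℝ, 0 < r → ∫⁻ x in (Metric.ball 0 r)ᶜ, ENNReal.ofReal (‖x‖ ^ (-b)) ∂μ =
      A * ENNReal.ofReal (r ^ (finrank ℝ E - b)) := by
  lift ∫⁻ x in (Metric.ball 0 1)ᶜ, ENNReal.ofReal (‖x‖ ^ (-b)) ∂μ to ℝ≥0
    using (integrableOn_compl_ball_norm_rpow μ hb).lintegral_lt_top.ne with A hA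
  refine ⟨A, fun r hr => ?_⟩
  rw [hA]
  refine setLIntegral_norm_rpow_smul μ hr measurableSet_ball.compl measurableSet_ball.compl
    fun x => ?_
  rw [Set.mem_compl_iff, Set.mem_compl_iff, mem_ball_zero_iff, mem_ball_zero_iff, norm_smul,
    Real.norm_of_nonneg hr.le, mul_lt_iff_lt_one_right hr]

end NormPowers

/-- The modulated Gaussian `e^{-t|ξ|² + i y·ξ}`: up to the factor `(2π)^{-n/2}`, the inverse Fourier
transform of the heat kernel centred at `y`. -/
def heatSymbol {n : ℕ} (t : ℝ) (y ξ : Space n) : ℂ :=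
  Complex.exp (-t * ‖ξ‖ ^ 2 + Complex.I * (inner ℝ y ξ : ℝ))

section HeatKernel

variable {n : ℕ}

theorem heatSymbol_eq_mul (t : ℝ) (y ξ : Space n) :
    heatSymbol t y ξ =
      Complex.exp (Complex.I * (inner ℝ y ξ : ℝ)) * (Real.exp (-(t * ‖ξ‖ ^ 2)) : ℝ) := by
  rw [heatSymbol, Complex.ofReal_exp, ← Complex.exp_add]
  congr 1
  push_cast
  ring

theorem norm_heatSymbol (t : ℝ) (y ξ : Space n) :
    ‖heatSymbol t y ξ‖ = Real.exp (-(t * ‖ξ‖ ^ 2)) := by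
  rw [heatSymbol_eq_mul, norm_mul, mul_comm Complex.I, Complex.norm_exp_ofReal_mul_I, one_mul,
    Complex.norm_real, Real.norm_of_nonneg (Real.exp_pos _).le]

theorem continuous_heatSymbol (t : ℝ) (y : Space n) : Continuous (heatSymbol t y) := by
  unfold heatSymbol
  fun_prop

theorem cexp_neg_inner_mul_heatSymbol (t : ℝ) (x y ξ : Space n) :
    Complex.exp (-(Complex.I * (inner ℝ ξ x : ℝ))) * heatSymbol t y ξ = heatSymbol t (y - x) ξ := by
  rw [heatSymbol, heatSymbol, ← Complex.exp_add, inner_sub_left, real_inner_comm x ξ]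
  congr 1
  push_cast
  ring

theorem integral_heatSymbol {t : ℝ} (ht : 0 < t) (y : Space n) :
    ∫ ξ, heatSymbol t y ξ =
      (((Real.pi / t) ^ ((n : ℝ) / 2) * Real.exp (-(‖y‖ ^ 2 / (4 * t))) : ℝ) : ℂ) := by
  have hgauss := GaussianFourier.integral_cexp_neg_mul_sq_norm_add (b := t)
    (by simpa using ht) Complex.I y
  rw [finrank_euclideanSpace_fin] at hgauss
  simp only [heatSymbol]
  rw [hgauss, Complex.ofReal_mul, Complex.ofReal_cpow (by positivity), Complex.ofReal_exp,
    Complex.I_sq]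
  push_cast
  ring_nf

theorem schwartzFourier_heatKernel {t : ℝ} (ht : 0 < t) (y ξ : Space n) :
    schwartzFourier n (heatKernel n t (-y)) ξ =
      (((2 * Real.pi) ^ (-(n : ℝ) / 2) : ℝ) : ℂ) * heatSymbol t y ξ := by
  have hmodulate (x : Space n) :
      Complex.exp (-(Complex.I * (inner ℝ (x - y) ξ : ℝ))) * heatKernel n t (-y) (x - y) =
        (((4 * Real.pi * t) ^ (-(n : ℝ) / 2) : ℝ) : ℂ) *
          Complex.exp (Complex.I * (inner ℝ y ξ : ℝ)) * heatSymbol (4 * t)⁻¹ (-ξ) x := by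
    rw [heatKernel_apply n t ht, sub_neg_eq_add, sub_add_cancel, heatSymbol_eq_mul, inner_sub_left,
      inner_neg_left, real_inner_comm x ξ, Complex.ofReal_mul, inv_mul_eq_div, Complex.ofReal_sub,
      mul_sub, neg_sub, sub_eq_add_neg, Complex.exp_add]
    push_cast
    ring_nf
  have hwidth : Real.pi / (4 * t)⁻¹ = 4 * Real.pi * t := by field_simp
  have hcancel : (((4 * Real.pi * t) ^ (-(n : ℝ) / 2) : ℝ) : ℂ) *
      (((4 * Real.pi * t) ^ ((n : ℝ) / 2) : ℝ) : ℂ) = 1 := by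
    rw [← Complex.ofReal_mul, ← Real.rpow_add (by positivity), neg_div, neg_add_cancel,
      Real.rpow_zero, Complex.ofReal_one]
  have hexponent : ‖ξ‖ ^ 2 / (4 * (4 * t)⁻¹) = t * ‖ξ‖ ^ 2 := by field_simp
  rw [schwartzFourier_apply]
  congr 1
  rw [← integral_sub_right_eq_self _ y]
  simp only [hmodulate]
  rw [integral_const_mul, integral_heatSymbol (by positivity), hwidth, norm_neg, hexponent,
    heatSymbol_eq_mul, Complex.ofReal_mul]
  linear_combination Complex.exp (Complex.I * (inner ℝ y ξ : ℝ)) *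
    (Real.exp (-(t * ‖ξ‖ ^ 2)) : ℝ) * hcancel

theorem schwartzFourier_schwartzFourier_heatKernel {t : ℝ} (ht : 0 < t) (y : Space n) :
    schwartzFourier n (schwartzFourier n (heatKernel n t (-y))) = heatKernel n t y := by
  have hconst : ((2 * Real.pi) ^ (-(n : ℝ) / 2)) ^ 2 * (Real.pi / t) ^ ((n : ℝ) / 2) =
      (4 * Real.pi * t) ^ (-(n : ℝ) / 2) := by
    have hsq : ((2 * Real.pi) ^ 2)⁻¹ * (Real.pi / t) = (4 * Real.pi * t)⁻¹ := by
      field_simp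
      norm_num
    rw [neg_div, Real.rpow_neg (by positivity), Real.rpow_neg (by positivity),
      ← Real.inv_rpow (by positivity), ← Real.inv_rpow (by positivity), ← hsq,
      Real.mul_rpow (by positivity) (by positivity), ← inv_pow,
      ← Real.rpow_pow_comm (by positivity)]
  ext x
  rw [schwartzFourier_apply]
  simp only [schwartzFourier_heatKernel ht, mul_left_comm (Complex.exp _),
    cexp_neg_inner_mul_heatSymbol]
  rw [integral_const_mul, integral_heatSymbol ht, heatKernel_apply n t ht, norm_sub_rev, ← hconst]
  push_cast
  ring

theorem heat_eq_fourierDist {m : ℕ} (f : 𝓢'(Space n, Vec m)) {t : ℝ} (ht : 0 < t) (y : Space n) :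
    heat f t y = fourierDist f (schwartzFourier n (heatKernel n t (-y))) := by
  rw [heat, ← schwartzFourier_schwartzFourier_heatKernel ht]
  rfl

end HeatKernel

/-- The heat flow `e^{tΔ}` on the Fourier side: `caloric g t` is the caloric extension, at time `t`,
of the tempered distribution whose Fourier transform is `g`. -/
def caloric {n : ℕ} {F : Type*} [NormedAddCommGroup F] [NormedSpace ℂ F] (g : Space n → F) (t : ℝ)
    (y : Space n) : F :=
  (((2 * Real.pi) ^ (-(n : ℝ) / 2) : ℝ) : ℂ) • ∫ ξ, heatSymbol t y ξ • g ξ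

section Caloric

variable {n : ℕ}

theorem heat_eq_caloric {m : ℕ} {f : 𝓢'(Space n, Vec m)} {g : Space n → Vec m}
    (hf : IsFunction (fourierDist f) g) {t : ℝ} (ht : 0 < t) {y : Space n}
    (hint : Integrable fun ξ => heatSymbol t y ξ • g ξ) : heat f t y = caloric g t y := by
  have hkernel : (fun ξ => schwartzFourier n (heatKernel n t (-y)) ξ • g ξ) = fun ξ =>
      (((2 * Real.pi) ^ (-(n : ℝ) / 2) : ℝ) : ℂ) • heatSymbol t y ξ • g ξ := by
    funext ξ
    rw [schwartzFourier_heatKernel ht, mul_smul]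
  rw [heat_eq_fourierDist f ht, hf.apply_eq_integral _ (by rw [hkernel]; exact hint.fun_smul _),
    hkernel, integral_smul, caloric]

theorem enorm_heatSymbol_le_one {t : ℝ} (ht : 0 ≤ t) (y ξ : Space n) : ‖heatSymbol t y ξ‖ₑ ≤ 1 := by
  rw [← ofReal_norm, norm_heatSymbol, ENNReal.ofReal_le_one, Real.exp_le_one_iff, neg_nonpos]
  positivity

theorem enorm_two_pi_rpow_le_one (n : ℕ) :
    ‖(((2 * Real.pi) ^ (-(n : ℝ) / 2) : ℝ) : ℂ)‖ₑ ≤ 1 := by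
  rw [← ofReal_norm, Complex.norm_real, Real.norm_of_nonneg (by positivity), ENNReal.ofReal_le_one]
  refine Real.rpow_le_one_of_one_le_of_nonpos (by linarith [Real.pi_gt_three]) ?_
  rw [neg_div, neg_nonpos]
  positivity

theorem enorm_sq_two_pi_rpow_mul (n : ℕ) : ‖(((2 * Real.pi) ^ (-(n : ℝ) / 2) : ℝ) : ℂ)‖ₑ ^ 2 *
    ENNReal.ofReal ((2 * Real.pi) ^ n) = 1 := by
  have hsq : ((2 * Real.pi) ^ (-(n : ℝ) / 2)) ^ 2 = ((2 * Real.pi) ^ n)⁻¹ := by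
    rw [← Real.rpow_mul_natCast (by positivity), Nat.cast_ofNat, div_mul_cancel₀ _ two_ne_zero,
      Real.rpow_neg (by positivity), Real.rpow_natCast]
  rw [← ofReal_norm, Complex.norm_real, Real.norm_of_nonneg (by positivity),
    ← ENNReal.ofReal_pow (by positivity), ← ENNReal.ofReal_mul (by positivity), hsq,
    inv_mul_cancel₀ (by positivity), ENNReal.ofReal_one]

section NormedSpace

variable {F : Type*} [NormedAddCommGroup F] [NormedSpace ℂ F]

theorem enorm_caloric_le (g : Space n → F) {t : ℝ} (ht : 0 ≤ t) (y : Space n) :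
    ‖caloric g t y‖ₑ ≤ ∫⁻ ξ, ‖g ξ‖ₑ := by
  rw [caloric, enorm_smul]
  refine (mul_le_of_le_one_left' (enorm_two_pi_rpow_le_one n)).trans
    ((enorm_integral_le_lintegral_enorm _).trans (lintegral_mono fun ξ => ?_))
  rw [enorm_smul]
  exact mul_le_of_le_one_left' (enorm_heatSymbol_le_one ht y ξ)

theorem caloric_add {g₁ g₂ : Space n → F} {t : ℝ} {y : Space n}
    (h₁ : Integrable fun ξ => heatSymbol t y ξ • g₁ ξ)
    (h₂ : Integrable fun ξ => heatSymbol t y ξ • g₂ ξ) :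
    caloric (fun ξ => g₁ ξ + g₂ ξ) t y = caloric g₁ t y + caloric g₂ t y := by
  simp only [caloric, smul_add]
  rw [integral_add h₁ h₂, smul_add]

theorem integrable_heatSymbol_smul {g : Space n → F} (hg : Integrable g) {t : ℝ} (ht : 0 ≤ t)
    (y : Space n) : Integrable fun ξ => heatSymbol t y ξ • g ξ := by
  refine hg.bdd_smul 1 (continuous_heatSymbol t y).aestronglyMeasurable (.of_forall fun ξ => ?_)
  simpa [← ofReal_norm] using enorm_heatSymbol_le_one ht y ξ

theorem memLp_norm_mul_exp_neg_sq {t : ℝ} (ht : 0 < t) (p : ℝ≥0∞) :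
    MemLp (fun ξ : Space n => ‖ξ‖ * Real.exp (-(t * ‖ξ‖ ^ 2))) p := by
  have hgauss (ξ : Space n) :
      gaussian n (t / 2) (half_pos ht) ξ = Real.exp (-(t / 2 * ‖ξ‖ ^ 2)) := rfl
  obtain ⟨C, -, hC⟩ := (gaussian n (t / 2) (half_pos ht)).decay 1 0
  refine ((gaussian n (t / 2) (half_pos ht)).memLp p).of_le_mul (c := C)
    (by fun_prop) (.of_forall fun ξ => ?_)
  have hbound := hC ξ
  rw [pow_one, norm_iteratedFDeriv_zero] at hbound
  have hsplit : Real.exp (-(t * ‖ξ‖ ^ 2)) =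
      Real.exp (-(t / 2 * ‖ξ‖ ^ 2)) * Real.exp (-(t / 2 * ‖ξ‖ ^ 2)) := by
    rw [← Real.exp_add]
    ring_nf
  rw [hsplit, ← hgauss, ← mul_assoc, norm_mul, norm_mul, norm_norm]
  gcongr

theorem memLp_exp_neg_sq_smul_norm_smul {p q r : ℝ≥0∞} [p.HolderTriple q r] {w : Space n → F}
    (hw : MemLp w q) {t : ℝ} (ht : 0 < t) :
    MemLp (fun ξ => ((Real.exp (-(t * ‖ξ‖ ^ 2)) : ℝ) : ℂ) • (‖ξ‖ : ℂ) • w ξ) r := by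
  simp only [smul_smul, ← Complex.ofReal_mul, mul_comm (Real.exp _)]
  exact hw.smul (memLp_norm_mul_exp_neg_sq ht p).ofReal

theorem heatSymbol_smul_eq (t : ℝ) (y ξ : Space n) (v : F) :
    heatSymbol t y ξ • v = Complex.exp (Complex.I * (inner ℝ y ξ : ℝ)) •
      ((Real.exp (-(t * ‖ξ‖ ^ 2)) : ℝ) : ℂ) • v := by
  rw [heatSymbol_eq_mul, mul_smul]

theorem integrable_heatSymbol_smul_norm_smul {w : Space n → F} (hw : MemLp w 2) {t : ℝ}
    (ht : 0 < t) (y : Space n) : Integrable fun ξ => heatSymbol t y ξ • (‖ξ‖ : ℂ) • w ξ := by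
  have hint := memLp_one_iff_integrable.1 (memLp_exp_neg_sq_smul_norm_smul (p := 2) (r := 1) hw ht)
  simp only [heatSymbol_smul_eq]
  refine hint.bdd_smul 1 (by fun_prop) (.of_forall fun ξ => ?_)
  rw [mul_comm, Complex.norm_exp_ofReal_mul_I]

end NormedSpace

section InnerProductSpace

variable {F : Type*} [NormedAddCommGroup F] [InnerProductSpace ℂ F] [CompleteSpace F]

theorem lintegral_enorm_sq_caloric {w : Space n → F} (hw : MemLp w 2) {t : ℝ} (ht : 0 < t) :
    ∫⁻ y, ‖caloric (fun ξ => (‖ξ‖ : ℂ) • w ξ) t y‖ₑ ^ 2 =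
      ∫⁻ ξ : Space n, ‖((Real.exp (-(t * ‖ξ‖ ^ 2)) : ℝ) : ℂ) • (‖ξ‖ : ℂ) • w ξ‖ₑ ^ 2 := by
  have hint := memLp_one_iff_integrable.1 (memLp_exp_neg_sq_smul_norm_smul (p := 2) (r := 1) hw ht)
  have hmemLp := memLp_exp_neg_sq_smul_norm_smul (p := ∞) (r := 2) hw ht
  simp only [caloric, heatSymbol_smul_eq, enorm_smul _ (integral _ _), mul_pow]
  rw [lintegral_const_mul' _ _ (by finiteness), lintegral_enorm_sq_integral_cexp_inner hint hmemLp,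
    finrank_euclideanSpace_fin, ← mul_assoc, enorm_sq_two_pi_rpow_mul, one_mul]

theorem lintegral_Ioi_enorm_mul_exp_neg_sq_le (s : ℝ) :
    ∫⁻ t in Set.Ioi 0, ‖s * Real.exp (-(t * s ^ 2))‖ₑ ^ 2 ≤ 2⁻¹ := by
  rcases eq_or_ne s 0 with rfl | hs
  · simp
  have hneg : -(2 * s ^ 2) < 0 := neg_neg_of_pos (by positivity)
  have hsq (t : ℝ) : ‖s * Real.exp (-(t * s ^ 2))‖ₑ ^ 2 =
      ENNReal.ofReal (s ^ 2 * Real.exp (-(2 * s ^ 2) * t)) := by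
    rw [← enorm_pow, Real.enorm_of_nonneg (by positivity), mul_pow, ← Real.exp_nat_mul]
    ring_nf
  have hval : s ^ 2 * (-Real.exp (-(2 * s ^ 2) * 0) / -(2 * s ^ 2)) = 2⁻¹ := by
    rw [mul_zero, Real.exp_zero]
    field_simp
  simp only [hsq]
  rw [← ofReal_integral_eq_lintegral_ofReal ((integrableOn_exp_mul_Ioi hneg 0).const_mul _)
    (.of_forall fun t => by positivity), integral_const_mul, integral_exp_mul_Ioi hneg, hval,
    ENNReal.ofReal_inv_of_pos two_pos, ENNReal.ofReal_ofNat]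

theorem lintegral_Ioi_lintegral_enorm_sq_caloric_le {w : Space n → F} (hw : MemLp w 2) :
    ∫⁻ t in Set.Ioi 0, ∫⁻ y, ‖caloric (fun ξ => (‖ξ‖ : ℂ) • w ξ) t y‖ₑ ^ 2 ≤
      2⁻¹ * ∫⁻ ξ : Space n, ‖w ξ‖ₑ ^ 2 := by
  have hsplit (t : ℝ) (ξ : Space n) :
      ‖((Real.exp (-(t * ‖ξ‖ ^ 2)) : ℝ) : ℂ) • (‖ξ‖ : ℂ) • w ξ‖ₑ ^ 2 =
        ‖‖ξ‖ * Real.exp (-(t * ‖ξ‖ ^ 2))‖ₑ ^ 2 * ‖w ξ‖ₑ ^ 2 := by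
    rw [smul_smul, ← Complex.ofReal_mul, enorm_smul, mul_pow, mul_comm (Real.exp _),
      ← ofReal_norm, Complex.norm_real, ofReal_norm]
  have hmeas : AEMeasurable (fun p : ℝ × Space n =>
      ‖‖p.2‖ * Real.exp (-(p.1 * ‖p.2‖ ^ 2))‖ₑ ^ 2 * ‖w p.2‖ₑ ^ 2)
      ((volume.restrict (Set.Ioi 0)).prod volume) :=
    (by fun_prop : Measurable _).aemeasurable.mul
      (hw.aestronglyMeasurable.comp_snd.enorm.pow_const 2)
  calc ∫⁻ t in Set.Ioi 0, ∫⁻ y, ‖caloric (fun ξ => (‖ξ‖ : ℂ) • w ξ) t y‖ₑ ^ 2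
      = ∫⁻ t in Set.Ioi 0, ∫⁻ ξ, ‖‖ξ‖ * Real.exp (-(t * ‖ξ‖ ^ 2))‖ₑ ^ 2 * ‖w ξ‖ₑ ^ 2 :=
        setLIntegral_congr_fun measurableSet_Ioi fun t ht => by
          simp only [lintegral_enorm_sq_caloric hw ht, hsplit]
    _ = ∫⁻ ξ, ∫⁻ t in Set.Ioi 0, ‖‖ξ‖ * Real.exp (-(t * ‖ξ‖ ^ 2))‖ₑ ^ 2 * ‖w ξ‖ₑ ^ 2 :=
        lintegral_lintegral_swap hmeas
    _ ≤ ∫⁻ ξ, 2⁻¹ * ‖w ξ‖ₑ ^ 2 := lintegral_mono fun ξ => by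
        dsimp only
        rw [lintegral_mul_const _ (by fun_prop)]
        gcongr
        exact lintegral_Ioi_enorm_mul_exp_neg_sq_le ‖ξ‖
    _ = 2⁻¹ * ∫⁻ ξ, ‖w ξ‖ₑ ^ 2 := lintegral_const_mul' _ _ (by finiteness)

end InnerProductSpace

end Caloric

section FrequencySplitting

variable {n m : ℕ} {f : 𝓢'(Space n, Vec m)} {g w : Space n → Vec m}

theorem enorm_heat_sq_le
    (hf : IsFunction (fourierDist f) fun ξ => g ξ + (‖ξ‖ : ℂ) • w ξ) (hg : Integrable g)
    (hw : MemLp w 2) {t : ℝ} (ht : 0 < t) (y : Space n) :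
    ‖heat f t y‖ₑ ^ 2 ≤
      2 * ((∫⁻ ξ, ‖g ξ‖ₑ) ^ 2 + ‖caloric (fun ξ => (‖ξ‖ : ℂ) • w ξ) t y‖ₑ ^ 2) := by
  have hint₁ := integrable_heatSymbol_smul hg ht.le y
  have hint₂ := integrable_heatSymbol_smul_norm_smul hw ht y
  rw [heat_eq_caloric hf ht (by simpa only [smul_add] using hint₁.fun_add hint₂),
    caloric_add hint₁ hint₂]
  calc _ ≤ ((∫⁻ ξ, ‖g ξ‖ₑ) + ‖caloric (fun ξ => (‖ξ‖ : ℂ) • w ξ) t y‖ₑ) ^ 2 := by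
        gcongr
        exact (enorm_add_le _ _).trans (by gcongr; exact enorm_caloric_le g ht.le y)
    _ ≤ _ := by
        simpa [show (2 : ℝ) - 1 = 1 by norm_num] using
          ENNReal.rpow_add_le_mul_rpow_add_rpow _ _ one_le_two

theorem lintegral_enorm_heat_sq_le
    (hf : IsFunction (fourierDist f) fun ξ => g ξ + (‖ξ‖ : ℂ) • w ξ) (hg : Integrable g)
    (hw : MemLp w 2) (x : Space n) (R T : ℝ) :
    ∫⁻ t in Set.Ioo 0 T, ∫⁻ y in Metric.ball x R, ‖heat f t y‖ₑ ^ 2 ≤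
      2 * (∫⁻ ξ, ‖g ξ‖ₑ) ^ 2 * volume (Metric.ball x R) * ENNReal.ofReal T +
        ∫⁻ ξ, ‖w ξ‖ₑ ^ 2 := by
  set u := fun (t : ℝ) (y : Space n) => ‖caloric (fun ξ => (‖ξ‖ : ℂ) • w ξ) t y‖ₑ ^ 2
  set N := ∫⁻ ξ, ‖g ξ‖ₑ
  have hball (t : ℝ) (ht : t ∈ Set.Ioo 0 T) : ∫⁻ y in Metric.ball x R, ‖heat f t y‖ₑ ^ 2 ≤
      2 * N ^ 2 * volume (Metric.ball x R) + 2 * ∫⁻ y, u t y :=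
    calc ∫⁻ y in Metric.ball x R, ‖heat f t y‖ₑ ^ 2
        ≤ ∫⁻ y in Metric.ball x R, (2 * N ^ 2 + 2 * u t y) := lintegral_mono fun y => by
          simpa only [mul_add] using enorm_heat_sq_le hf hg hw ht.1 y
      _ = 2 * N ^ 2 * volume (Metric.ball x R) + 2 * ∫⁻ y in Metric.ball x R, u t y := by
          rw [lintegral_add_left measurable_const, setLIntegral_const,
            lintegral_const_mul' _ _ (by finiteness)]
      _ ≤ _ := by gcongr; exact Measure.restrict_le_self
  calc ∫⁻ t in Set.Ioo 0 T, ∫⁻ y in Metric.ball x R, ‖heat f t y‖ₑ ^ 2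
      ≤ ∫⁻ t in Set.Ioo 0 T, (2 * N ^ 2 * volume (Metric.ball x R) + 2 * ∫⁻ y, u t y) :=
        setLIntegral_mono' measurableSet_Ioo hball
    _ = 2 * N ^ 2 * volume (Metric.ball x R) * ENNReal.ofReal T +
          2 * ∫⁻ t in Set.Ioo 0 T, ∫⁻ y, u t y := by
        rw [lintegral_add_left measurable_const, setLIntegral_const,
          lintegral_const_mul' _ _ (by finiteness), Real.volume_Ioo, sub_zero]
    _ ≤ 2 * N ^ 2 * volume (Metric.ball x R) * ENNReal.ofReal T +
          2 * (2⁻¹ * ∫⁻ ξ, ‖w ξ‖ₑ ^ 2) := by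
        gcongr
        exact (lintegral_mono_set Set.Ioo_subset_Ioi_self).trans
          (lintegral_Ioi_lintegral_enorm_sq_caloric_le hw)
    _ = _ := by
        rw [← mul_assoc 2 2⁻¹, ENNReal.mul_inv_cancel two_ne_zero ENNReal.ofNat_ne_top, one_mul]

end FrequencySplitting

section PowerBounds

open Module (finrank)

variable {E F : Type*} [NormedAddCommGroup E] [NormedAddCommGroup F] {g : E → F} {a r : ℝ} {M : ℝ≥0}

theorem enorm_inv_norm_smul_sq_le [NormedSpace ℂ F] {ξ : E} (hξ : ξ ≠ 0)
    (hg : ‖g ξ‖ₑ ≤ M * ENNReal.ofReal (‖ξ‖ ^ (-a))) :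
    ‖(‖ξ‖ : ℂ)⁻¹ • g ξ‖ₑ ^ 2 ≤ M ^ 2 * ENNReal.ofReal (‖ξ‖ ^ (-(2 * a + 2))) := by
  have hξ₀ : 0 < ‖ξ‖ := norm_pos_iff.2 hξ
  have hpow : ‖ξ‖ ^ (-(2 * a + 2)) = (‖ξ‖⁻¹ * ‖ξ‖ ^ (-a)) ^ 2 := by
    rw [← Real.rpow_neg_one, ← Real.rpow_add hξ₀, ← Real.rpow_mul_natCast hξ₀.le]
    congr 1
    push_cast
    ring
  calc ‖(‖ξ‖ : ℂ)⁻¹ • g ξ‖ₑ ^ 2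
      ≤ (ENNReal.ofReal ‖ξ‖⁻¹ * (M * ENNReal.ofReal (‖ξ‖ ^ (-a)))) ^ 2 := by
        rw [enorm_smul, ← ofReal_norm (_ : ℂ), norm_inv, Complex.norm_real, norm_norm]
        gcongr
    _ = M ^ 2 * ENNReal.ofReal (‖ξ‖ ^ (-(2 * a + 2))) := by
        rw [hpow, ENNReal.ofReal_pow (by positivity), ENNReal.ofReal_mul (by positivity)]
        ring

theorem indicator_ball_add_norm_smul_indicator_compl_ball [NormedSpace ℂ F] (hr : 0 < r) (ξ : E) :
    (Metric.ball 0 r).indicator g ξ +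
      (‖ξ‖ : ℂ) • (Metric.ball 0 r)ᶜ.indicator (fun ξ => (‖ξ‖ : ℂ)⁻¹ • g ξ) ξ = g ξ := by
  by_cases hξr : ξ ∈ Metric.ball 0 r
  · simp [hξr]
  · have hξ : ξ ≠ 0 := (ne_of_mem_of_not_mem (Metric.mem_ball_self hr) hξr).symm
    rw [Set.indicator_of_notMem hξr, Set.indicator_of_mem hξr, zero_add,
      smul_inv_smul₀ (by simpa using hξ)]

variable [MeasurableSpace E] [BorelSpace E] {μ : Measure E}

theorem lintegral_enorm_indicator_ball_le
    (hg : ∀ᵐ ξ ∂μ, ‖g ξ‖ₑ ≤ M * ENNReal.ofReal (‖ξ‖ ^ (-a))) :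
    ∫⁻ ξ, ‖(Metric.ball 0 r).indicator g ξ‖ₑ ∂μ ≤
      M * ∫⁻ ξ in Metric.ball 0 r, ENNReal.ofReal (‖ξ‖ ^ (-a)) ∂μ := by
  simp only [enorm_indicator_eq_indicator_enorm]
  rw [lintegral_indicator measurableSet_ball, ← lintegral_const_mul' _ _ ENNReal.coe_ne_top]
  exact lintegral_mono_ae (ae_restrict_of_ae hg)

theorem lintegral_enorm_sq_indicator_compl_ball_le [NormedSpace ℂ F] (hr : 0 < r)
    (hg : ∀ᵐ ξ ∂μ, ‖g ξ‖ₑ ≤ M * ENNReal.ofReal (‖ξ‖ ^ (-a))) :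
    ∫⁻ ξ, ‖(Metric.ball 0 r)ᶜ.indicator (fun ξ => (‖ξ‖ : ℂ)⁻¹ • g ξ) ξ‖ₑ ^ 2 ∂μ ≤
      M ^ 2 * ∫⁻ ξ in (Metric.ball 0 r)ᶜ, ENNReal.ofReal (‖ξ‖ ^ (-(2 * a + 2))) ∂μ := by
  rw [← lintegral_const_mul' _ _ (by finiteness), ← lintegral_indicator measurableSet_ball.compl]
  refine lintegral_mono_ae (hg.mono fun ξ hξ => ?_)
  by_cases hξr : ξ ∈ (Metric.ball (0 : E) r)ᶜ
  · rw [Set.indicator_of_mem hξr, Set.indicator_of_mem hξr]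
    exact enorm_inv_norm_smul_sq_le (ne_of_mem_of_not_mem (Metric.mem_ball_self hr) hξr).symm hξ
  · simp [hξr]

theorem exists_frequency_splitting [NormedSpace ℝ E] [FiniteDimensional ℝ E] [Nontrivial E]
    (μ : Measure E) [μ.IsAddHaarMeasure] (ha : a < finrank ℝ E) (ha' : finrank ℝ E < 2 * a + 2) :
    ∃ A₁ A₂ : ℝ≥0, ∀ (F : Type*) [NormedAddCommGroup F] [NormedSpace ℂ F] (g : E → F) (M : ℝ≥0),
      AEStronglyMeasurable g μ → (∀ᵐ ξ ∂μ, ‖g ξ‖ₑ ≤ M * ENNReal.ofReal (‖ξ‖ ^ (-a))) →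
      ∀ r : ℝ, 0 < r → ∃ g₁ w : E → F, (∀ ξ, g₁ ξ + (‖ξ‖ : ℂ) • w ξ = g ξ) ∧
        Integrable g₁ μ ∧ MemLp w 2 μ ∧
        ∫⁻ ξ, ‖g₁ ξ‖ₑ ∂μ ≤ M * (A₁ * ENNReal.ofReal (r ^ (finrank ℝ E - a))) ∧
        ∫⁻ ξ, ‖w ξ‖ₑ ^ 2 ∂μ ≤
          M ^ 2 * (A₂ * ENNReal.ofReal (r ^ (finrank ℝ E - (2 * a + 2)))) := by
  obtain ⟨A₁, hA₁⟩ := exists_setLIntegral_ball_norm_rpow_eq μ ha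
  obtain ⟨A₂, hA₂⟩ := exists_setLIntegral_compl_ball_norm_rpow_eq μ ha'
  refine ⟨A₁, A₂, fun F _ _ g M hgm hg r hr => ?_⟩
  have hlow := lintegral_enorm_indicator_ball_le (r := r) hg
  have hhigh := lintegral_enorm_sq_indicator_compl_ball_le hr hg
  rw [hA₁ r hr] at hlow
  rw [hA₂ r hr] at hhigh
  refine ⟨_, _, indicator_ball_add_norm_smul_indicator_compl_ball hr,
    ⟨hgm.indicator measurableSet_ball, hlow.trans_lt (by finiteness)⟩, ⟨?_, ?_⟩, hlow, hhigh⟩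
  · refine AEStronglyMeasurable.indicator ?_ measurableSet_ball.compl
    exact AEStronglyMeasurable.smul (by fun_prop) hgm
  · have hfinite := hhigh.trans_lt (by finiteness)
    rw [lintegral_enorm_sq_eq_eLpNorm_sq] at hfinite
    exact (ENNReal.pow_lt_top_iff.1 hfinite).resolve_right two_ne_zero

end PowerBounds

section Carleson

variable {n m : ℕ}

theorem carleson_sq (f : 𝓢'(Space n, Vec m)) (x : Space n) (R : ℝ) :
    carleson f x R ^ 2 = (volume (Metric.ball x R))⁻¹ *
      ∫⁻ t in Set.Ioo 0 (R ^ 2), ∫⁻ y in Metric.ball x R, ‖heat f t y‖ₑ ^ 2 := by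
  rw [carleson, ← ENNReal.rpow_natCast, ← ENNReal.rpow_mul]
  norm_num

theorem ofReal_inv_rpow_sq_mul_ofReal_sq {R : ℝ} (hR : 0 < R) (d a : ℝ) :
    ENNReal.ofReal (R⁻¹ ^ (d - a)) ^ 2 * ENNReal.ofReal (R ^ 2) =
      ENNReal.ofReal (R ^ (a + 1 - d)) ^ 2 := by
  rw [← ENNReal.ofReal_pow (by positivity), ← ENNReal.ofReal_mul (by positivity),
    ← ENNReal.ofReal_pow (by positivity), ← mul_pow, Real.inv_rpow hR.le, ← Real.rpow_neg hR.le,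
    ← Real.rpow_add_one hR.ne']
  ring_nf

theorem ofReal_inv_rpow_eq_mul_ofReal_pow {R : ℝ} (hR : 0 < R) (d : ℕ) (a : ℝ) :
    ENNReal.ofReal (R⁻¹ ^ (d - (2 * a + 2))) =
      ENNReal.ofReal (R ^ (a + 1 - d)) ^ 2 * ENNReal.ofReal (R ^ d) := by
  rw [← ENNReal.ofReal_pow (by positivity), ← ENNReal.ofReal_mul (by positivity),
    Real.inv_rpow hR.le, ← Real.rpow_neg hR.le, ← Real.rpow_mul_natCast hR.le, ← Real.rpow_natCast,
    ← Real.rpow_add hR]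
  congr 2
  push_cast
  ring

theorem ofReal_pow_finrank_eq_inv_mul_addHaar_ball {E : Type*} [NormedAddCommGroup E]
    [NormedSpace ℝ E] [FiniteDimensional ℝ E] [MeasurableSpace E] [BorelSpace E] (μ : Measure E)
    [μ.IsAddHaarMeasure] (x : E) {R : ℝ} (hR : 0 < R) :
    ENNReal.ofReal (R ^ Module.finrank ℝ E) =
      (μ (Metric.ball 0 1))⁻¹ * μ (Metric.ball x R) := by
  rw [Measure.addHaar_ball_of_pos _ _ hR, mul_left_comm, ENNReal.inv_mul_cancel
    (Metric.measure_ball_pos _ _ one_pos).ne' measure_ball_lt_top.ne, mul_one]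

theorem exists_carleson_sq_le [NeZero n] (m : ℕ) {a : ℝ} (ha : a < n) (ha' : n < 2 * a + 2) :
    ∃ K : ℝ≥0, ∀ (f : 𝓢'(Space n, Vec m)) (g : Space n → Vec m) (M : ℝ≥0),
      IsFunction (fourierDist f) g → (∀ᵐ ξ, ‖g ξ‖ₑ ≤ M * ENNReal.ofReal (‖ξ‖ ^ (-a))) →
      ∀ (x : Space n) (R : ℝ), 0 < R →
        carleson f x R ^ 2 ≤ K * (ENNReal.ofReal (R ^ (a + 1 - n)) * M) ^ 2 := by
  rw [← finrank_euclideanSpace_fin (𝕜 := ℝ) (n := n)] at ha ha'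
  obtain ⟨A₁, A₂, hsplit⟩ := exists_frequency_splitting (E := Space n) volume ha ha'
  set v := volume (Metric.ball (0 : Space n) 1)
  have hv₀ : v ≠ 0 := (Metric.measure_ball_pos _ _ one_pos).ne'
  refine ⟨2 * A₁ ^ 2 + A₂ * (v⁻¹).toNNReal, fun f g M hf hg x R hR => ?_⟩
  obtain ⟨g₁, w, hsum, hg₁, hw, hlow, hhigh⟩ :=
    hsplit (Vec m) g M hf.1.aestronglyMeasurable hg R⁻¹ (inv_pos.2 hR)
  have hheat := lintegral_enorm_heat_sq_le (by simpa only [hsum] using hf) hg₁ hw x R (R ^ 2)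
  have hpow := ofReal_pow_finrank_eq_inv_mul_addHaar_ball volume x hR
  rw [finrank_euclideanSpace_fin] at hlow hhigh hpow
  set P := ENNReal.ofReal (R ^ (a + 1 - n))
  set V := volume (Metric.ball x R)
  have hV₀ : V ≠ 0 := (Metric.measure_ball_pos _ _ hR).ne'
  have hVtop : V ≠ ∞ := measure_ball_lt_top.ne
  calc carleson f x R ^ 2
      ≤ V⁻¹ * (2 * (M * (A₁ * ENNReal.ofReal (R⁻¹ ^ (n - a)))) ^ 2 * V * ENNReal.ofReal (R ^ 2) +
          M ^ 2 * (A₂ * ENNReal.ofReal (R⁻¹ ^ (n - (2 * a + 2))))) := by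
        rw [carleson_sq]
        gcongr
        exact hheat.trans (by gcongr)
    _ = V⁻¹ * (2 * A₁ ^ 2 * M ^ 2 * V *
          (ENNReal.ofReal (R⁻¹ ^ (n - a)) ^ 2 * ENNReal.ofReal (R ^ 2)) +
          M ^ 2 * (A₂ * ENNReal.ofReal (R⁻¹ ^ (n - (2 * a + 2))))) := by ring
    _ = V⁻¹ * V * ((2 * A₁ ^ 2 + A₂ * v⁻¹) * (P * M) ^ 2) := by
        rw [ofReal_inv_rpow_sq_mul_ofReal_sq hR, ofReal_inv_rpow_eq_mul_ofReal_pow hR, hpow]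
        ring
    _ = _ := by
        rw [ENNReal.inv_mul_cancel hV₀ hVtop, one_mul]
        push_cast [ENNReal.coe_toNNReal (ENNReal.inv_ne_top.2 hv₀)]
        rfl

theorem enorm_le_mul_rpow_neg_of_rpow_mul_le {F : Type*} [NormedAddCommGroup F] {s a : ℝ}
    (hs : 0 < s) {v : F} {N : ℝ≥0∞} (h : ENNReal.ofReal (s ^ a) * ‖v‖ₑ ≤ N) :
    ‖v‖ₑ ≤ N * ENNReal.ofReal (s ^ (-a)) := by
  rw [Real.rpow_neg hs.le, ENNReal.ofReal_inv_of_pos (by positivity), ← div_eq_mul_inv,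
    ENNReal.le_div_iff_mul_le (.inl (ENNReal.ofReal_pos.2 (by positivity)).ne')
      (.inl ENNReal.ofReal_ne_top), mul_comm]
  exact h

theorem exists_carleson_le_pmNorm [NeZero n] (m : ℕ) {a : ℝ} (ha : a < n) (ha' : n < 2 * a + 2) :
    ∃ K : ℝ≥0, ∀ (f : 𝓢'(Space n, Vec m)) (x : Space n) (R : ℝ), 0 < R →
      carleson f x R ≤ K * ENNReal.ofReal (R ^ (a + 1 - n)) * pmNorm a f := by
  obtain ⟨K, hK⟩ := exists_carleson_sq_le m ha ha'
  refine ⟨K + 1, fun f x R hR => ?_⟩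
  set P := ((K + 1 : ℝ≥0) : ℝ≥0∞) * ENNReal.ofReal (R ^ (a + 1 - n))
  have hP₀ : P ≠ 0 := mul_ne_zero (by simp) (ENNReal.ofReal_pos.2 (by positivity)).ne'
  have hPtop : P ≠ ∞ := by finiteness
  simp_rw [pmNorm, ENNReal.mul_iInf_of_ne hP₀ hPtop]
  refine le_iInf₂ fun g hg => ?_
  have hess := ENNReal.ae_le_essSup (μ := volume)
    fun ξ : Space n => ENNReal.ofReal (‖ξ‖ ^ a) * ‖g ξ‖ₑ
  generalize essSup (fun ξ : Space n => ENNReal.ofReal (‖ξ‖ ^ a) * ‖g ξ‖ₑ) volume = N at hess ⊢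
  rcases eq_or_ne N ∞ with rfl | hN
  · simp [ENNReal.mul_top hP₀]
  lift N to ℝ≥0 using hN
  have hsq := hK f g N hg (by
    filter_upwards [hess, Measure.ae_ne volume 0] with ξ hle hξ
    exact enorm_le_mul_rpow_neg_of_rpow_mul_le (norm_pos_iff.2 hξ) hle) x R hR
  refine (ENNReal.pow_le_pow_left_iff two_ne_zero).1 (hsq.trans ?_)
  rw [mul_assoc, mul_pow ((K + 1 : ℝ≥0) : ℝ≥0∞)]
  gcongr
  exact_mod_cast (le_self_add.trans (le_self_pow₀ le_add_self two_ne_zero) : K ≤ (K + 1) ^ 2)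

theorem exists_bmoInvNorm_le [NeZero n] (m : ℕ) :
    ∃ C : ℝ≥0, ∀ f : 𝓢'(Space n, Vec m), bmoInvNorm f ≤ C * pmNorm (n - 1) f := by
  have hn : (1 : ℝ) ≤ n := by exact_mod_cast NeZero.one_le
  obtain ⟨C, hC⟩ := exists_carleson_le_pmNorm (n := n) m (a := n - 1) (by linarith) (by linarith)
  refine ⟨C, fun f => iSup_le fun x => iSup₂_le fun R hR => ?_⟩
  simpa using hC f x R hR

theorem exists_bmoInvNormLocal_le [NeZero n] (m : ℕ) {θ : ℝ} (hθ : 0 < θ) (hθ' : θ ≤ 1) :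
    ∃ C : ℝ≥0, ∀ (T : ℝ) (f : 𝓢'(Space n, Vec m)),
      bmoInvNormLocal T f ≤ C * ENNReal.ofReal (T ^ ((1 - θ) / 2)) * pmNorm (n - θ) f := by
  have hn : (1 : ℝ) ≤ n := by exact_mod_cast NeZero.one_le
  obtain ⟨C, hC⟩ := exists_carleson_le_pmNorm (n := n) m (a := n - θ) (by linarith) (by linarith)
  refine ⟨C, fun T f => iSup₂_le fun x R => iSup₂_le fun hR hRT => (hC f x R hR).trans ?_⟩
  gcongr
  calc R ^ (n - θ + 1 - n) = (R ^ 2) ^ ((1 - θ) / 2) := by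
        rw [← Real.rpow_natCast_mul hR.le]
        push_cast
        ring_nf
    _ ≤ T ^ ((1 - θ) / 2) := by gcongr

end Carleson

end Majorization

end

open Majorization in
theorem mainTheorem4_general (n m : ℕ) (hn : 1 ≤ n) :
    (∀ (θ α ω : ℝ) (h : Space n → ℝ≥0∞), IsRadialAlgebraicKernel n θ α ω h →
      ContinuouslyEmbeds (m := m) (majorizationNorm h) (pmNorm (n - θ))) ∧
    ContinuouslyEmbeds (n := n) (m := m) (pmNorm (n - 1)) bmoInvNorm ∧
    ∀ θ : ℝ, 0 < θ → θ ≤ 1 →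
      (∀ T : ℝ, 0 < T →
        ContinuouslyEmbeds (n := n) (m := m) (pmNorm (n - θ)) (bmoInvNormLocal T)) ∧
      ∃ C : ℝ≥0, ∀ T : ℝ, 0 < T → ∀ f : 𝓢'(Space n, Vec m),
        bmoInvNormLocal T f ≤ C * ENNReal.ofReal (T ^ ((1 - θ) / 2)) * pmNorm (n - θ) f := by
  have : NeZero n := ⟨Nat.one_le_iff_ne_zero.1 hn⟩
  refine ⟨fun θ α ω h H => ?_, ?_, fun θ hθ hθ' => ?_⟩
  · obtain ⟨C, hC⟩ := H.exists_le_rpow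
    exact continuouslyEmbeds_majorizationNorm_pmNorm hC
  · obtain ⟨C, hC⟩ := exists_bmoInvNorm_le (n := n) m
    exact continuouslyEmbeds_of_le hC
  · obtain ⟨C, hC⟩ := exists_bmoInvNormLocal_le (n := n) m hθ hθ'
    refine ⟨fun T _ => continuouslyEmbeds_of_le
      (C := C * (T ^ ((1 - θ) / 2)).toNNReal) fun f => ?_, C, fun T _ => hC T⟩
    rw [ENNReal.coe_mul]
    exact hC T f

theorem mainTheorem4 (n m : ℕ) (hn : 2 ≤ n) :
    -- the case `θ = 1`
    ((∀ (α ω : ℝ) (h : Majorization.Space n → ℝ≥0∞),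
        Majorization.IsRadialAlgebraicKernel n 1 α ω h →
          Majorization.ContinuouslyEmbeds (n := n) (m := m)
            (Majorization.majorizationNorm h) (Majorization.pmNorm ((n : ℝ) - 1))) ∧
      Majorization.ContinuouslyEmbeds (n := n) (m := m)
        (Majorization.pmNorm ((n : ℝ) - 1)) Majorization.bmoInvNorm) ∧
    -- the case `0 < θ < 1`
    ∀ θ : ℝ, 0 < θ → θ < 1 →
      (∀ (α ω : ℝ) (h : Majorization.Space n → ℝ≥0∞),
        Majorization.IsRadialAlgebraicKernel n θ α ω h →
          Majorization.ContinuouslyEmbeds (n := n) (m := m)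
            (Majorization.majorizationNorm h) (Majorization.pmNorm ((n : ℝ) - θ))) ∧
      (∀ T : ℝ, 0 < T →
        Majorization.ContinuouslyEmbeds (n := n) (m := m)
          (Majorization.pmNorm ((n : ℝ) - θ)) (Majorization.bmoInvNormLocal T)) ∧
      ∃ C : ℝ≥0, ∀ T : ℝ, 0 < T →
        ∀ f : 𝓢'(Majorization.Space n, Majorization.Vec m),
          Majorization.pmNorm ((n : ℝ) - θ) f < ∞ →
            Majorization.bmoInvNormLocal T f ≤
              C * ENNReal.ofReal (T ^ ((1 - θ) / 2)) * Majorization.pmNorm ((n : ℝ) - θ) f := by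
  obtain ⟨hPM, hBMO, hlocal⟩ := mainTheorem4_general n m (by omega)
  exact ⟨⟨hPM 1, hBMO⟩, fun θ hθ hθ' => ⟨hPM θ, (hlocal θ hθ hθ'.le).imp_right
    fun ⟨C, hC⟩ => ⟨C, fun T hT f _ => hC T hT f⟩⟩⟩
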